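/- Let $G$ be a group with a Garside structure $(G,P,\Delta)$ of finite type: $P\subseteq G$ is a submonoid with $P\cap P^{-1}=\{1\}$ and $\Delta\in P$, such that the relation $a\preccurlyeq b\Leftrightarrow a^{-1}b\in P$ is a lattice order on $G$ (with meet $\wedge$), the set $[1,\Delta]=\{s: 1\preccurlyeq s\preccurlyeq\Delta\}$ of simple elements is finite and generates $G$, $\Delta^{-1}P\Delta=P$, and for every $x\in P\setminus\{1\}$ the number of factors in a decomposition of $x$ into elements of $P\setminus\{1\}$ is bounded. Every $x\in G$ has a left normal form $x=\Delta^p x_1\cdots x_r$, where $r\ge 0$, $x_i\in[1,\Delta]\setminus\{1,\Delta\}$ and $(x_i^{-1}\Delta)\wedge x_{i+1}=1$ for $1\le i<r$; put $\inf(x)=p$, $\ell(x)=r$. For $r>0$ let the cycling of $x$ be $\mathbf c(x)=g^{-1}xg$ with $g=\Delta^p x_1\Delta^{-p}$, and let the decycling of $x$ be $\mathbf d(x)=x_r\,x\,x_r^{-1}$; for $r=0$ let $\mathbf c(x)=\mathbf d(x)=x$. Let $\iota(x)=x\Delta^{-\inf(x)}\wedge\Delta$, $\mathfrak p(x)=\iota(x)\wedge\iota(x^{-1})$,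 and let the cyclic sliding of $x$ be $\mathfrak s(x)=\mathfrak p(x)^{-1}\,x\,\mathfrak p(x)$. Write $x^G$ for the conjugacy class of $x$ and $\ell_s(x)=\min\{\ell(y): y\in x^G\}$ for the summit canonical length, and set - $\mathrm{SS}(x)=\{y\in x^G: \inf(y)\text{ is maximal in }x^G\}$, - $\mathrm{SSS}(x)=\{y\in x^G: \ell(y)\text{ is minimal in }x^G\}$, - $\mathrm{USS}(x)=\{y\in \mathrm{SSS}(x): \mathbf c^m(y)=y\text{ for some }m\ge 1\}$, - $\mathrm{RSSS}(x)=\{y\in x^G: \mathbf c^m(y)=y\text{ and }\mathbf d^n(y)=y\text{ for some }m,n\ge 1\}$, - $\mathrm{SC}(x)=\{y\in x^G: \mathfrak s^m(y)=y\text{ for some }m\ge 1\}$. Then for every $x\in G$: $$\mathrm{SC}(x)\subseteq \mathrm{RSSS}(x)\subseteq \mathrm{USS}(x)\subseteq \mathrm{SSS}(x)\subseteq \mathrm{SS}(x).$$ If $\ell_s(x)>1$, then $\mathrm{SC}(x)=\mathrm{RSSS}(x)$. If $\ell_s(x)=1$, then $\mathrm{SC}(x)\subseteq\mathrm{RSSS}(x)=\mathrm{USS}(x)=\mathrm{SSS}(x)$.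 In the last case the inclusion can be strict: let $B_4$ be the braid group on four strands with standard generators $\sigma_1,\sigma_2,\sigma_3$, let $P$ be the submonoid generated by $\sigma_1,\sigma_2,\sigma_3$, and let $\Delta=\sigma_1(\sigma_2\sigma_1)(\sigma_3\sigma_2\sigma_1)$. Then $(B_4,P,\Delta)$ is a Garside structure of finite type, and for $x=\sigma_1\sigma_2\sigma_3$ one has $\ell_s(x)=1$ and $\mathrm{SC}(x)\subsetneq\mathrm{RSSS}(x)$. -/

import Mathlib

/-- The relation `a ≼ b ↔ a⁻¹ b ∈ P` on a group `G` with a submonoid `P`. -/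
def PrefixLE {G : Type*} [Group G] (P : Submonoid G) (a b : G) : Prop := a⁻¹ * b ∈ P

/-- A Garside structure `(G, P, Δ)` on a group `G`. -/
structure GarsideStructure (G : Type*) [Group G] where
  /-- the monoid of positive elements -/
  P : Submonoid G
  /-- the Garside element -/
  Δ : G
  /-- `Δ` is positive -/
  Δ_mem : Δ ∈ P
  /-- `P ∩ P⁻¹ = {1}` -/
  eq_one_of_mem_of_inv_mem : ∀ a : G, a ∈ P → a⁻¹ ∈ P → a = 1
  /-- existence of greatest common divisors for `≼` -/
  exists_gcd : ∀ a b : G, ∃ d : G, PrefixLE P d a ∧ PrefixLE P d b ∧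
    ∀ c : G, PrefixLE P c a → PrefixLE P c b → PrefixLE P c d
  /-- existence of least common multiples for `≼` -/
  exists_lcm : ∀ a b : G, ∃ m : G, PrefixLE P a m ∧ PrefixLE P b m ∧
    ∀ c : G, PrefixLE P a c → PrefixLE P b c → PrefixLE P m c
  /-- the simple elements generate `G` -/
  closure_simples : Subgroup.closure {s : G | PrefixLE P 1 s ∧ PrefixLE P s Δ} = ⊤
  /-- `Δ⁻¹ P Δ = P` -/
  conj_mem_iff : ∀ a : G, Δ⁻¹ * a * Δ ∈ P ↔ a ∈ P
  /-- the number of factors in a decomposition of `x ∈ P \ {1}` into non-trivial positive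
  elements is bounded -/
  exists_norm_bound : ∀ x ∈ P, x ≠ 1 → ∃ N : ℕ, ∀ l : List G,
    (∀ a ∈ l, a ∈ P ∧ a ≠ 1) → l.prod = x → l.length ≤ N

namespace GarsideStructure

variable {G : Type*} [Group G] (S : GarsideStructure G)

/-- The set `[1, Δ]` of simple elements. -/
def simples : Set G := {s : G | PrefixLE S.P 1 s ∧ PrefixLE S.P s S.Δ}

/-- The structure is of finite type: there are finitely many simple elements. -/
def FiniteType : Prop := S.simples.Finite

/-- The greatest common divisor `a ∧ b` with respect to `≼`. -/
noncomputable def gcd (a b : G) : G := Classical.choose (S.exists_gcd a b)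

theorem gcd_spec (a b : G) : PrefixLE S.P (S.gcd a b) a ∧ PrefixLE S.P (S.gcd a b) b ∧
    ∀ c : G, PrefixLE S.P c a → PrefixLE S.P c b → PrefixLE S.P c (S.gcd a b) :=
  Classical.choose_spec (S.exists_gcd a b)

/-- The right complement `∂(s) = s⁻¹ Δ`. -/
def rightComplement (s : G) : G := s⁻¹ * S.Δ

/-- The product of the simple elements `a` and `b` is left weighted: `∂(a) ∧ b = 1`. -/
def LeftWeighted (a b : G) : Prop := S.gcd (S.rightComplement a) b = 1

/-- `x = Δ ^ p * x₁ * ⋯ * xᵣ` is a left normal form, where `l = [x₁, …, xᵣ]`: every `xᵢ` is simple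
and different from `1` and `Δ`, and consecutive factors are left weighted. -/
def IsLeftNormalForm (x : G) (p : ℤ) (l : List G) : Prop :=
  x = S.Δ ^ p * l.prod ∧ (∀ s ∈ l, s ∈ S.simples ∧ s ≠ 1 ∧ s ≠ S.Δ) ∧ l.IsChain S.LeftWeighted

/-- The left normal form `(p, [x₁, …, xᵣ])` of `x`. -/
noncomputable def leftNormalForm (x : G) : ℤ × List G :=
  Classical.epsilon fun q : ℤ × List G => S.IsLeftNormalForm x q.1 q.2

/-- The infimum of `x`. -/
noncomputable def inf (x : G) : ℤ := (S.leftNormalForm x).1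

/-- The canonical length of `x`. -/
noncomputable def len (x : G) : ℕ := (S.leftNormalForm x).2.length

/-- The supremum of `x`. -/
noncomputable def sup (x : G) : ℤ := S.inf x + S.len x

/-- The summit canonical length `ℓₛ(x)`: the minimal canonical length in the conjugacy class. -/
noncomputable def summitLen (x : G) : ℕ := sInf (S.len '' conjugatesOf x)

/-- Cycling: `x = Δ ^ p x₁ ⋯ xᵣ` is conjugated by `τ⁻ᵖ(x₁) = Δ ^ p x₁ Δ ^ (-p)`. An element of
canonical length `0` is fixed. -/
noncomputable def cycling (x : G) : G :=
  match (S.leftNormalForm x).2.head? with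
  | none => x
  | some x₁ =>
    (S.Δ ^ S.inf x * x₁ * S.Δ ^ (-S.inf x))⁻¹ * x * (S.Δ ^ S.inf x * x₁ * S.Δ ^ (-S.inf x))

/-- Decycling: `x = Δ ^ p x₁ ⋯ xᵣ` is conjugated by `xᵣ⁻¹`. An element of canonical length `0` is
fixed. -/
noncomputable def decycling (x : G) : G :=
  match (S.leftNormalForm x).2.getLast? with
  | none => x
  | some xr => xr * x * xr⁻¹

/-- The initial factor `ι(x) = x Δ ^ (-inf x) ∧ Δ`. -/
noncomputable def initialFactor (x : G) : G := S.gcd (x * S.Δ ^ (-S.inf x)) S.Δ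

/-- The preferred prefix `𝔭(x) = ι(x) ∧ ι(x⁻¹)`. -/
noncomputable def preferredPrefix (x : G) : G := S.gcd (S.initialFactor x) (S.initialFactor x⁻¹)

/-- Cyclic sliding `𝔰(x) = 𝔭(x)⁻¹ x 𝔭(x)`. -/
noncomputable def cyclicSliding (x : G) : G := (S.preferredPrefix x)⁻¹ * x * S.preferredPrefix x

/-- The summit set of `x`. -/
def SS (x : G) : Set G := {y ∈ conjugatesOf x | ∀ z ∈ conjugatesOf x, S.inf z ≤ S.inf y}

/-- The super summit set of `x`. -/
def SSS (x : G) : Set G := {y ∈ conjugatesOf x | ∀ z ∈ conjugatesOf x, S.len y ≤ S.len z}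

/-- The ultra summit set of `x`. -/
def USS (x : G) : Set G := {y ∈ S.SSS x | ∃ m : ℕ, 1 ≤ m ∧ S.cycling^[m] y = y}

/-- The reduced super summit set of `x`. -/
def RSSS (x : G) : Set G :=
  {y ∈ conjugatesOf x | (∃ m : ℕ, 1 ≤ m ∧ S.cycling^[m] y = y) ∧
    ∃ n : ℕ, 1 ≤ n ∧ S.decycling^[n] y = y}

/-- The set of sliding circuits of `x`. -/
def SC (x : G) : Set G := {y ∈ conjugatesOf x | ∃ m : ℕ, 1 ≤ m ∧ S.cyclicSliding^[m] y = y}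

end GarsideStructure

/-- The braid relations between the generators `σ₁, …, σₙ₋₁` (indexed from `0`):
`σᵢ σⱼ = σⱼ σᵢ` for `|i - j| ≥ 2` and `σᵢ σⱼ σᵢ = σⱼ σᵢ σⱼ` for `|i - j| = 1`. -/
def braidRels (n : ℕ) : Set (FreeGroup (Fin (n - 1))) :=
  {r | ∃ i j : Fin (n - 1), (i : ℕ) + 2 ≤ j ∧
      r = .of i * .of j * (.of j * .of i)⁻¹} ∪
  {r | ∃ i j : Fin (n - 1), (i : ℕ) + 1 = j ∧
      r = .of i * .of j * .of i * (.of j * .of i * .of j)⁻¹}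

/-- The braid group `Bₙ` on `n` strands. -/
abbrev BraidGroup (n : ℕ) : Type := PresentedGroup (braidRels n)

/-- The standard generator `σᵢ₊₁` of `Bₙ`. -/
def braidGen (n : ℕ) (i : Fin (n - 1)) : BraidGroup n := PresentedGroup.of i

/-- The Artin Garside structure of `B₄`: the positive elements are the products of the
standard generators, and `Δ = σ₁ (σ₂ σ₁) (σ₃ σ₂ σ₁)`. -/
def IsArtinStructureB4 (S : GarsideStructure (BraidGroup 4)) : Prop :=
  S.P = Submonoid.closure (Set.range (braidGen 4)) ∧
  S.Δ = braidGen 4 0 * (braidGen 4 1 * braidGen 4 0) *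
    (braidGen 4 2 * braidGen 4 1 * braidGen 4 0)

/-!
Translations `a ↦ u a Δ ^ m` are automorphisms of the prefix order, since `Δ` normalises `P`. That
`g⁻¹ x g` has infimum at least `p` says that `g` lies below its translate by `a ↦ x a Δ ^ (-p)`,
and that it has supremum at most `q` says the same for `a ↦ x⁻¹ a Δ ^ q`. For `p = inf x` and
`q = sup x` put `A a = x a Δ ^ (-p - 1)` and `B a = x⁻¹ a Δ ^ (q - 1)`. Up to powers of `Δ`,
cycling conjugates by `1 ∧ A 1`, decycling by `1 ∧ B 1` and cyclic sliding by `1 ∧ A 1 ∧ B 1`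
(`cycling_conj`, `decycling_conj`, `cyclicSliding_conj`). As long as the infimum is unchanged,
iterated cycling thus conjugates by `1 ∧ A 1 ∧ ⋯ ∧ A ^ k 1`. If some conjugate has larger infimum,
these meets are bounded below, so in finite type they become stationary
(`FiniteType.exists_iterate_meetTranslate_le`), and a stationary meet conjugates to an element of
larger infimum. Hence cycling-periodic elements have maximal infimum, and dually for decycling and
the supremum.

If the canonical length is at least `2`, then `A B 1 = Δ ^ (q - p - 2)` is positive, so
`1 ∧ A 1 ∧ B 1 = 1 ∧ A 1 ∧ B 1 ∧ A B 1` and on the super summit set cyclic sliding is the composite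
of the commuting maps cycling and decycling (`cyclicSliding_eq_of_mem_SSS`). The same
formula shows that sliding-periodic elements have maximal infimum and minimal supremum: otherwise
the meets for cycling, say, become stationary, and this is preserved when meets for decycling are
taken (`isExtremal_of_iterate_cyclicSliding_eq`). On a finite set, a composite of commuting maps is
periodic at a point exactly if both maps are. If the canonical length is `1`, cycling and decycling
are conjugations by powers of `Δ`, hence periodic, and an element of canonical length `1` is never
conjugate to a power of `Δ` (`eq_zpow_of_conj_eq_zpow`).

For the braid group on four strands, the positive monoid is described by an explicit relation on
words (`PositiveBraid.WordEquiv`) that has left cancellation and least common multiples of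
generators built in. Its transitivity is Garside's induction on length, with one computation for
the three generators (`PositiveBraid.WordEquiv.cube`). Inverting the central element `Δ²` embeds
the monoid into the group (`PositiveBraid.wordEquiv_of_braid_eq`), and local least common multiples
give the lattice property. Finally, `σ₁ σ₂ σ₃` slides to `σ₁ σ₃ σ₂`, which is fixed by sliding.
-/

/-! ### The prefix order and its greatest common divisors -/

theorem PrefixLE.refl {G : Type*} [Group G] (P : Submonoid G) (a : G) : PrefixLE P a a := by
  simp [PrefixLE]

theorem PrefixLE.trans {G : Type*} [Group G] {P : Submonoid G} {a b c : G} (h₁ : PrefixLE P a b)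
    (h₂ : PrefixLE P b c) : PrefixLE P a c := by
  simpa [PrefixLE, mul_assoc] using P.mul_mem h₁ h₂

theorem prefixLE_mul_left_iff {G : Type*} [Group G] (P : Submonoid G) (g a b : G) :
    PrefixLE P (g * a) (g * b) ↔ PrefixLE P a b := by
  simp [PrefixLE, mul_assoc]

namespace GarsideStructure

variable {G : Type*} [Group G] (S : GarsideStructure G)

theorem le_refl (a : G) : PrefixLE S.P a a := PrefixLE.refl S.P a

variable {S} in
theorem le_trans {a b c : G} (h₁ : PrefixLE S.P a b) (h₂ : PrefixLE S.P b c) :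
    PrefixLE S.P a c := h₁.trans h₂

variable {S} in
theorem le_antisymm {a b : G} (h₁ : PrefixLE S.P a b) (h₂ : PrefixLE S.P b a) : a = b := by
  have h := S.eq_one_of_mem_of_inv_mem (a⁻¹ * b) h₁ (by simpa [PrefixLE] using h₂)
  exact (inv_mul_eq_one.mp h)

theorem mul_le_mul_left_iff (g a b : G) :
    PrefixLE S.P (g * a) (g * b) ↔ PrefixLE S.P a b := prefixLE_mul_left_iff S.P g a b

theorem conj_zpow_mem_iff (k : ℤ) (a : G) : (S.Δ ^ k)⁻¹ * a * S.Δ ^ k ∈ S.P ↔ a ∈ S.P := by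
  induction k using Int.induction_on generalizing a with
  | zero => simp
  | succ n ih =>
    rw [← ih a, ← S.conj_mem_iff ((S.Δ ^ (n : ℤ))⁻¹ * a * S.Δ ^ (n : ℤ)), zpow_add_one]
    simp [mul_assoc]
  | pred n ih =>
    rw [← ih a, ← S.conj_mem_iff ((S.Δ ^ (-(n : ℤ) - 1))⁻¹ * a * S.Δ ^ (-(n : ℤ) - 1)),
      zpow_sub_one]
    simp [mul_assoc]

/-- Since `Δ` normalises `P`, right multiplication by a power of `Δ` is an automorphism of the
prefix order. -/
theorem mul_zpow_le_mul_zpow_iff (k : ℤ) (a b : G) :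
    PrefixLE S.P (a * S.Δ ^ k) (b * S.Δ ^ k) ↔ PrefixLE S.P a b := by
  unfold PrefixLE
  rw [← S.conj_zpow_mem_iff k (a⁻¹ * b)]
  simp [mul_assoc]

theorem le_gcd_iff (a b c : G) :
    PrefixLE S.P c (S.gcd a b) ↔ PrefixLE S.P c a ∧ PrefixLE S.P c b := by
  obtain ⟨h₁, h₂, h₃⟩ := S.gcd_spec a b
  exact ⟨fun h => ⟨le_trans h h₁, le_trans h h₂⟩, fun h => h₃ c h.1 h.2⟩

theorem gcd_le_left (a b : G) : PrefixLE S.P (S.gcd a b) a := (S.gcd_spec a b).1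

theorem gcd_le_right (a b : G) : PrefixLE S.P (S.gcd a b) b := (S.gcd_spec a b).2.1

theorem eq_of_forall_le_iff {a b : G} (h : ∀ c, PrefixLE S.P c a ↔ PrefixLE S.P c b) : a = b :=
  le_antisymm ((h a).1 (S.le_refl a)) ((h b).2 (S.le_refl b))

theorem gcd_comm (a b : G) : S.gcd a b = S.gcd b a :=
  S.eq_of_forall_le_iff fun c => by rw [le_gcd_iff, le_gcd_iff, and_comm]

variable {S} in
theorem gcd_eq_left {a b : G} (h : PrefixLE S.P a b) : S.gcd a b = a :=
  le_antisymm (S.gcd_le_left a b) ((S.le_gcd_iff _ _ _).2 ⟨S.le_refl a, h⟩)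

theorem mul_gcd (g a b : G) : g * S.gcd a b = S.gcd (g * a) (g * b) := by
  refine S.eq_of_forall_le_iff fun c => ?_
  have key : ∀ d, PrefixLE S.P c (g * d) ↔ PrefixLE S.P (g⁻¹ * c) d := fun d => by
    rw [← S.mul_le_mul_left_iff g (g⁻¹ * c) d, mul_inv_cancel_left]
  rw [le_gcd_iff, key, key, key, le_gcd_iff]

theorem gcd_mul_zpow (k : ℤ) (a b : G) :
    S.gcd a b * S.Δ ^ k = S.gcd (a * S.Δ ^ k) (b * S.Δ ^ k) := by
  refine S.eq_of_forall_le_iff fun c => ?_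
  have key : ∀ d, PrefixLE S.P c (d * S.Δ ^ k) ↔ PrefixLE S.P (c * (S.Δ ^ k)⁻¹) d := fun d => by
    rw [← S.mul_zpow_le_mul_zpow_iff k (c * (S.Δ ^ k)⁻¹) d, inv_mul_cancel_right]
  rw [le_gcd_iff, key, key, key, le_gcd_iff]

theorem one_le_iff (a : G) : PrefixLE S.P 1 a ↔ a ∈ S.P := by simp [PrefixLE]

theorem zpow_le_zpow {p q : ℤ} (h : p ≤ q) : PrefixLE S.P (S.Δ ^ p) (S.Δ ^ q) := by
  obtain ⟨n, rfl⟩ := Int.le.dest h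
  have : S.Δ ^ n ∈ S.P := S.P.pow_mem S.Δ_mem n
  simpa [PrefixLE, zpow_add] using this

theorem le_mul_zpow (a : G) {k : ℤ} (hk : 0 ≤ k) : PrefixLE S.P a (a * S.Δ ^ k) := by
  have := S.zpow_le_zpow hk
  simpa [PrefixLE] using this

variable {S} in
theorem zpow_le_zpow_iff (hΔ : S.Δ ≠ 1) {p q : ℤ} :
    PrefixLE S.P (S.Δ ^ p) (S.Δ ^ q) ↔ p ≤ q := by
  refine ⟨fun h => ?_, S.zpow_le_zpow⟩
  by_contra hlt
  -- if `Δ ^ p ≼ Δ ^ q` with `q < p`, then `Δ ^ (q + 1) ≼ Δ ^ q`, so that `Δ⁻¹` is positive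
  have h' := le_trans (S.zpow_le_zpow (show q + 1 ≤ p by omega)) h
  refine hΔ (S.eq_one_of_mem_of_inv_mem _ S.Δ_mem ?_)
  simpa [PrefixLE, zpow_add] using h'

variable {S} in
theorem zpow_add_le_mul {a b : G} {p q : ℤ} (ha : PrefixLE S.P (S.Δ ^ p) a)
    (hb : PrefixLE S.P (S.Δ ^ q) b) : PrefixLE S.P (S.Δ ^ (p + q)) (a * b) := by
  rw [zpow_add]
  exact le_trans ((S.mul_zpow_le_mul_zpow_iff q _ _).2 ha) ((S.mul_le_mul_left_iff a _ _).2 hb)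

variable {S} in
theorem mul_le_zpow_add {a b : G} {p q : ℤ} (ha : PrefixLE S.P a (S.Δ ^ p))
    (hb : PrefixLE S.P b (S.Δ ^ q)) : PrefixLE S.P (a * b) (S.Δ ^ (p + q)) := by
  rw [zpow_add]
  exact le_trans ((S.mul_le_mul_left_iff a _ _).2 hb) ((S.mul_zpow_le_mul_zpow_iff q _ _).2 ha)

theorem inv_le_zpow_iff (a : G) (p : ℤ) :
    PrefixLE S.P a⁻¹ (S.Δ ^ p) ↔ PrefixLE S.P (S.Δ ^ (-p)) a := by
  rw [← S.mul_le_mul_left_iff a, ← S.mul_zpow_le_mul_zpow_iff (-p)]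
  simp

theorem zpow_le_inv_iff (a : G) (p : ℤ) :
    PrefixLE S.P (S.Δ ^ p) a⁻¹ ↔ PrefixLE S.P a (S.Δ ^ (-p)) := by
  rw [← S.mul_le_mul_left_iff a, ← S.mul_zpow_le_mul_zpow_iff (-p)]
  simp

/-- Every element lies between two powers of `Δ`. -/
theorem exists_zpow_bounds (a : G) :
    ∃ p q : ℤ, PrefixLE S.P (S.Δ ^ p) a ∧ PrefixLE S.P a (S.Δ ^ q) := by
  have ha : a ∈ Subgroup.closure {s : G | PrefixLE S.P 1 s ∧ PrefixLE S.P s S.Δ} := by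
    rw [S.closure_simples]; trivial
  induction ha using Subgroup.closure_induction with
  | mem s hs => exact ⟨0, 1, by simpa using hs.1, by simpa using hs.2⟩
  | one => exact ⟨0, 0, by simpa using S.le_refl 1, by simpa using S.le_refl 1⟩
  | mul a b _ _ iha ihb =>
    obtain ⟨p, q, h₁, h₂⟩ := iha
    obtain ⟨p', q', h₁', h₂'⟩ := ihb
    exact ⟨p + p', q + q', zpow_add_le_mul h₁ h₁', mul_le_zpow_add h₂ h₂'⟩
  | inv a _ iha =>
    obtain ⟨p, q, h₁, h₂⟩ := iha
    exact ⟨-q, -p, (S.zpow_le_inv_iff a _).2 (by simpa using h₂),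
      (S.inv_le_zpow_iff a _).2 (by simpa using h₁)⟩

theorem Δ_ne_one [Nontrivial G] : S.Δ ≠ 1 := by
  intro h
  obtain ⟨a, ha⟩ := exists_ne (1 : G)
  obtain ⟨p, q, h₁, h₂⟩ := S.exists_zpow_bounds a
  rw [h, one_zpow] at h₁ h₂
  exact ha (le_antisymm h₂ h₁)

/-! ### Left normal forms -/

/-- The head and the tail of the greedy decomposition: a positive divisor of `Δ ^ (k + 1)` is its
gcd with `Δ` times a divisor of `Δ ^ k`. -/
theorem le_gcd_mul_zpow {w : G} {k : ℤ} (hk : 0 ≤ k) (hle : PrefixLE S.P w (S.Δ ^ (k + 1))) :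
    PrefixLE S.P w (S.gcd w S.Δ * S.Δ ^ k) := by
  rw [gcd_mul_zpow, le_gcd_iff, ← zpow_one_add, add_comm 1 k]
  exact ⟨S.le_mul_zpow w hk, hle⟩

/-- The first `k` factors of a left normal form are the gcd with `Δ ^ k`. -/
theorem gcd_prod_pow (l : List G) (hs : ∀ s ∈ l, s ∈ S.simples) (hc : l.IsChain S.LeftWeighted)
    (k : ℕ) : S.gcd l.prod (S.Δ ^ k) = (l.take k).prod := by
  have hpos : ∀ l : List G, (∀ s ∈ l, s ∈ S.simples) → PrefixLE S.P 1 l.prod := by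
    intro l hl
    rw [one_le_iff]
    exact S.P.list_prod_mem fun s hs => (S.one_le_iff s).1 (hl s hs).1
  -- the case `k = 1`, by looking at the first two factors
  have head : ∀ (a : G) (l : List G), (∀ s ∈ a :: l, s ∈ S.simples) →
      (a :: l).IsChain S.LeftWeighted → S.gcd (a * l.prod) S.Δ = a := by
    intro a l
    induction l generalizing a with
    | nil =>
      intro hs _
      simpa using gcd_eq_left (hs a (by simp)).2
    | cons b l ih =>
      intro hs hc
      have hb := ih b (fun s h => hs s (by simp_all)) hc.tail
      have hw : S.gcd (a⁻¹ * S.Δ) b = 1 := (List.isChain_cons_cons.1 hc).1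
      have ha : PrefixLE S.P S.Δ (a * S.Δ) := by
        have := (S.mul_zpow_le_mul_zpow_iff 1 1 a).2 (hs a (by simp)).1
        simpa using this
      calc S.gcd (a * (b :: l).prod) S.Δ
          = S.gcd S.Δ (a * S.gcd (b * l.prod) S.Δ) := by
            refine S.eq_of_forall_le_iff fun c => ?_
            rw [mul_gcd]
            simp only [le_gcd_iff, List.prod_cons]
            exact ⟨fun h => ⟨h.2, h.1, le_trans h.2 ha⟩, fun h => ⟨h.2.1, h.1⟩⟩
        _ = a * S.gcd (a⁻¹ * S.Δ) b := by rw [hb, mul_gcd, mul_inv_cancel_left]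
        _ = a := by rw [hw, mul_one]
  induction k generalizing l with
  | zero =>
    simp only [pow_zero, List.take_zero, List.prod_nil]
    rw [gcd_comm]
    exact gcd_eq_left (hpos l hs)
  | succ k ih =>
    cases l with
    | nil =>
      have h := S.zpow_le_zpow (show (0 : ℤ) ≤ (k + 1 : ℕ) by positivity)
      rw [zpow_zero, zpow_natCast] at h
      simpa using gcd_eq_left h
    | cons a l =>
      have ha := hs a (by simp)
      have hk : S.Δ ^ (k + 1) = S.Δ * S.Δ ^ (k : ℤ) := by rw [zpow_natCast, pow_succ']
      rw [List.take_succ_cons, List.prod_cons, List.prod_cons,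
        ← ih l (fun s h => hs s (by simp [h])) hc.tail, mul_gcd]
      refine S.eq_of_forall_le_iff fun c => ?_
      simp only [le_gcd_iff]
      refine and_congr_right fun hca => ?_
      have key : PrefixLE S.P c (a * S.Δ ^ (k : ℤ)) ↔ PrefixLE S.P c (S.Δ ^ (k + 1)) := by
        constructor
        · intro h
          rw [hk]
          exact le_trans h ((S.mul_zpow_le_mul_zpow_iff k a S.Δ).2 ha.2)
        · intro h
          conv_rhs => rw [← head a l hs hc]
          rw [gcd_mul_zpow, le_gcd_iff, ← hk]
          exact ⟨le_trans hca (S.le_mul_zpow _ (by positivity)), h⟩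
      rw [← key, zpow_natCast]

/-- A positive element which divides `Δ ^ k` but is not divisible by `Δ` is a product of a left
normal form. -/
theorem exists_normal_list (k : ℕ) (w : G) (h₁ : PrefixLE S.P 1 w)
    (h₂ : PrefixLE S.P w (S.Δ ^ k)) (h₃ : ¬ PrefixLE S.P S.Δ w) :
    ∃ l : List G, w = l.prod ∧ (∀ s ∈ l, s ∈ S.simples ∧ s ≠ 1 ∧ s ≠ S.Δ) ∧
      l.IsChain S.LeftWeighted ∧ (∀ s ∈ l.head?, s = S.gcd w S.Δ) := by
  induction k generalizing w with
  | zero => exact ⟨[], by simpa using le_antisymm (by simpa using h₂) h₁, by simp, by simp, by simp⟩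
  | succ k ih =>
    have hk := S.le_gcd_mul_zpow (w := w) (k := k) (by positivity) (by exact_mod_cast h₂)
    by_cases ha : S.gcd w S.Δ = 1
    · exact ih w h₁ (by simpa [ha] using hk) h₃
    set a := S.gcd w S.Δ with hadef
    have haΔ : a ≠ S.Δ := fun h => h₃ (h ▸ S.gcd_le_left w S.Δ)
    have has : a ∈ S.simples :=
      ⟨(S.le_gcd_iff _ _ _).2 ⟨h₁, (S.one_le_iff _).2 S.Δ_mem⟩, S.gcd_le_right w S.Δ⟩
    have hw : S.gcd (a⁻¹ * S.Δ) (a⁻¹ * w) = 1 := by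
      rw [← mul_gcd, gcd_comm, ← hadef, inv_mul_cancel]
    have hrc : PrefixLE S.P (a⁻¹ * S.Δ) S.Δ := by
      have := (S.mul_zpow_le_mul_zpow_iff 1 1 a).2 has.1
      rw [← S.mul_le_mul_left_iff a, mul_inv_cancel_left]
      simpa using this
    obtain ⟨l, hl, hs, hc, hh⟩ := ih (a⁻¹ * w)
      (by simpa using (S.mul_le_mul_left_iff a⁻¹ a w).2 (S.gcd_le_left w S.Δ))
      (by simpa [mul_assoc] using (S.mul_le_mul_left_iff a⁻¹ _ _).2 hk) (by
        intro hΔ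
        rw [gcd_eq_left (le_trans hrc hΔ)] at hw
        exact haΔ (inv_mul_eq_one.1 hw))
    refine ⟨a :: l, by simp [← hl], ?_, ?_, by simp⟩
    · intro s hs'
      rcases List.mem_cons.1 hs' with rfl | h
      · exact ⟨has, ha, haΔ⟩
      · exact hs s h
    · rw [List.isChain_cons]
      refine ⟨fun b hb => ?_, hc⟩
      rw [hh b hb]
      refine Eq.trans (S.eq_of_forall_le_iff fun c => ?_) hw
      simp only [le_gcd_iff, rightComplement]
      exact ⟨fun h => ⟨h.1, h.2.1⟩, fun h => ⟨h.1, h.2, le_trans h.1 hrc⟩⟩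

variable {S} in
theorem exists_isLeftNormalForm (hΔ : S.Δ ≠ 1) (x : G) : ∃ p l, S.IsLeftNormalForm x p l := by
  obtain ⟨m, n, hm, hn⟩ := S.exists_zpow_bounds x
  obtain ⟨p, hp, hmax⟩ := Int.exists_greatest_of_bdd (P := fun p => PrefixLE S.P (S.Δ ^ p) x)
    ⟨n, fun z hz => (zpow_le_zpow_iff hΔ).1 (le_trans hz hn)⟩ ⟨m, hm⟩
  have hpn : p ≤ n := (zpow_le_zpow_iff hΔ).1 (le_trans hp hn)
  obtain ⟨l, hl, hs, hc, -⟩ := S.exists_normal_list (n - p).toNat ((S.Δ ^ p)⁻¹ * x)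
    (by simpa using (S.mul_le_mul_left_iff (S.Δ ^ p)⁻¹ _ _).2 hp)
    (by
      rw [← zpow_natCast, Int.toNat_of_nonneg (by omega), sub_eq_neg_add, zpow_add, zpow_neg]
      exact (S.mul_le_mul_left_iff (S.Δ ^ p)⁻¹ _ _).2 hn)
    (by
      intro h
      have := hmax (p + 1) (by
        rw [← S.mul_le_mul_left_iff (S.Δ ^ p)⁻¹]
        simpa [zpow_add] using h)
      omega)
  exact ⟨p, l, by simp [← hl], hs, hc⟩

variable {S} in
theorem isLeftNormalForm_leftNormalForm (hΔ : S.Δ ≠ 1) (x : G) :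
    S.IsLeftNormalForm x (S.inf x) (S.leftNormalForm x).2 := by
  obtain ⟨p, l, h⟩ := exists_isLeftNormalForm hΔ x
  exact Classical.epsilon_spec (p := fun q : ℤ × List G => S.IsLeftNormalForm x q.1 q.2) ⟨(p, l), h⟩

variable {S} in
theorem IsLeftNormalForm.gcd_eq {x : G} {p : ℤ} {l : List G} (h : S.IsLeftNormalForm x p l)
    (k : ℕ) : S.gcd x (S.Δ ^ (p + k)) = S.Δ ^ p * (l.take k).prod := by
  rw [← S.gcd_prod_pow l (fun s hs => (h.2.1 s hs).1) h.2.2, mul_gcd, ← h.1, zpow_add, zpow_natCast]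

variable {S} in
theorem IsLeftNormalForm.zpow_le_iff (hΔ : S.Δ ≠ 1) {x : G} {p : ℤ} {l : List G}
    (h : S.IsLeftNormalForm x p l) (n : ℤ) : PrefixLE S.P (S.Δ ^ n) x ↔ n ≤ p := by
  have h1 := h.gcd_eq 1
  have h0 := h.gcd_eq 0
  refine ⟨fun hn => ?_, fun hn => le_trans (S.zpow_le_zpow hn) ?_⟩
  · by_contra hlt
    have hle : PrefixLE S.P (S.Δ ^ (p + 1)) x := le_trans (S.zpow_le_zpow (by omega)) hn
    rw [gcd_comm, Nat.cast_one, gcd_eq_left hle, zpow_add, zpow_one, mul_left_cancel_iff] at h1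
    cases l with
    | nil => exact hΔ (by simpa using h1)
    | cons a l => exact (h.2.1 a (by simp)).2.2 (by simpa using h1.symm)
  · have := S.gcd_le_left x (S.Δ ^ (p + (0 : ℕ)))
    rw [h0] at this
    simpa using this

variable {S} in
theorem IsLeftNormalForm.le_zpow_iff (hΔ : S.Δ ≠ 1) {x : G} {p : ℤ} {l : List G}
    (h : S.IsLeftNormalForm x p l) (n : ℤ) : PrefixLE S.P x (S.Δ ^ n) ↔ p + l.length ≤ n := by
  refine ⟨fun hn => ?_, fun hn => le_trans ?_ (S.zpow_le_zpow hn)⟩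
  · by_contra hlt
    have hp : p ≤ n := (zpow_le_zpow_iff hΔ).1 (le_trans ((h.zpow_le_iff hΔ p).2 le_rfl) hn)
    obtain ⟨k, rfl⟩ := Int.le.dest hp
    have hk : k < l.length := by omega
    -- the divisor `x ∧ Δ ^ (p + length - 1)` omits the last factor
    have h1 := h.gcd_eq (l.length - 1)
    rw [gcd_eq_left (le_trans hn (S.zpow_le_zpow (by omega)))] at h1
    have h2 := h.1.symm.trans h1
    have hne : l ≠ [] := by rintro rfl; simp at hk
    have h3 := List.take_append_getLast l hne
    rw [mul_left_cancel_iff] at h2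
    have h4 : (l.take (l.length - 1)).prod * l.getLast hne = l.prod := by
      conv_rhs => rw [← h3]
      rw [List.prod_append, List.prod_singleton]
    rw [h2] at h4
    exact (h.2.1 _ (List.getLast_mem hne)).2.1 (by simpa using h4)
  · have h1 := h.gcd_eq l.length
    rw [List.take_length, ← h.1] at h1
    rw [← h1]
    exact S.gcd_le_right _ _

end GarsideStructure

namespace GarsideStructure

variable {G : Type*} [Group G] {S : GarsideStructure G}

/-! ### Infimum, supremum and the three conjugations as gcd formulas -/

theorem zpow_le_iff (hΔ : S.Δ ≠ 1) (x : G) (n : ℤ) : PrefixLE S.P (S.Δ ^ n) x ↔ n ≤ S.inf x :=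
  (isLeftNormalForm_leftNormalForm hΔ x).zpow_le_iff hΔ n

theorem le_zpow_iff (hΔ : S.Δ ≠ 1) (x : G) (n : ℤ) : PrefixLE S.P x (S.Δ ^ n) ↔ S.sup x ≤ n :=
  (isLeftNormalForm_leftNormalForm hΔ x).le_zpow_iff hΔ n

variable (S) in
theorem sup_sub_inf (x : G) : S.sup x - S.inf x = S.len x := by
  simp [sup]

theorem zpow_inf_le (hΔ : S.Δ ≠ 1) (x : G) : PrefixLE S.P (S.Δ ^ S.inf x) x :=
  (zpow_le_iff hΔ x _).2 le_rfl

theorem le_zpow_sup (hΔ : S.Δ ≠ 1) (x : G) : PrefixLE S.P x (S.Δ ^ S.sup x) :=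
  (le_zpow_iff hΔ x _).2 le_rfl

theorem inf_inv (hΔ : S.Δ ≠ 1) (x : G) : S.inf x⁻¹ = -S.sup x := by
  refine _root_.eq_of_forall_le_iff fun n => ?_
  rw [← zpow_le_iff hΔ, zpow_le_inv_iff, le_zpow_iff hΔ]
  omega

/-- An element of canonical length `0` is a power of `Δ`. -/
theorem eq_zpow_of_len_eq_zero (hΔ : S.Δ ≠ 1) {x : G} (h : S.len x = 0) : x = S.Δ ^ S.inf x := by
  have hx := (isLeftNormalForm_leftNormalForm hΔ x).1
  rw [List.length_eq_zero_iff.1 h] at hx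
  simpa using hx

/-- Cycling is conjugation by `x Δ ^ (-inf x) ∧ Δ`, also for canonical length `0`. -/
theorem cycling_eq (hΔ : S.Δ ≠ 1) (x : G) :
    S.cycling x = (S.gcd (x * S.Δ ^ (-S.inf x)) S.Δ)⁻¹ * x * S.gcd (x * S.Δ ^ (-S.inf x)) S.Δ := by
  have h := isLeftNormalForm_leftNormalForm hΔ x
  have h1 := congrArg (· * S.Δ ^ (-S.inf x)) (h.gcd_eq 1)
  simp only [gcd_mul_zpow, ← zpow_add, Nat.cast_one, add_neg_cancel_comm, zpow_one] at h1
  rw [h1, cycling]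
  cases hl : (S.leftNormalForm x).2 with
  | nil => simp
  | cons a l => simp

/-- Decycling is conjugation by `1 ∧ x⁻¹ Δ ^ (sup x - 1)`, also for canonical length `0`. -/
theorem decycling_eq (hΔ : S.Δ ≠ 1) (x : G) :
    S.decycling x = (S.gcd 1 (x⁻¹ * S.Δ ^ (S.sup x - 1)))⁻¹ * x *
      S.gcd 1 (x⁻¹ * S.Δ ^ (S.sup x - 1)) := by
  have h := isLeftNormalForm_leftNormalForm hΔ x
  rw [decycling]
  cases hl : (S.leftNormalForm x).2.getLast? with
  | none =>
    rw [List.getLast?_eq_none_iff] at hl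
    have h0 : S.len x = 0 := by simp [len, hl]
    -- here `x` is a power of `Δ`, and so is the conjugating element
    have hx : x⁻¹ * S.Δ ^ (S.sup x - 1) = S.Δ ^ (-1 : ℤ) := by
      conv_lhs => enter [1, 1]; rw [eq_zpow_of_len_eq_zero hΔ h0]
      rw [← zpow_neg, ← zpow_add]
      congr 1
      simp only [sup, h0]
      push_cast
      ring
    have hle : PrefixLE S.P (S.Δ ^ (-1 : ℤ)) 1 := by
      simpa using S.zpow_le_zpow (show (-1 : ℤ) ≤ 0 by norm_num)
    rw [hx, gcd_comm, gcd_eq_left hle]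
    change x = _
    conv_rhs => enter [1, 2]; rw [eq_zpow_of_len_eq_zero hΔ h0]
    rw [← zpow_neg, ← zpow_add, ← zpow_add]
    conv_lhs => rw [eq_zpow_of_len_eq_zero hΔ h0]
    congr 1
    ring
  | some a =>
    obtain ⟨l, hl'⟩ := List.getLast?_eq_some_iff.1 hl
    have hlen : S.len x = l.length + 1 := by simp [len, hl']
    have h1 := h.gcd_eq l.length
    have hx := h.1
    rw [hl'] at h1 hx
    have hsup : S.inf x + (l.length : ℤ) = S.sup x - 1 := by rw [sup, hlen]; push_cast; ring
    rw [List.take_left, hsup] at h1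
    have h2 : S.gcd 1 (x⁻¹ * S.Δ ^ (S.sup x - 1)) = a⁻¹ := by
      have := S.mul_gcd x⁻¹ x (S.Δ ^ (S.sup x - 1))
      rw [inv_mul_cancel, h1] at this
      rw [← this]
      conv_lhs => enter [1, 1]; rw [hx]
      simp [mul_assoc]
    rw [h2, inv_inv]

/-- Cyclic sliding is conjugation by `x Δ ^ (-inf x) ∧ Δ ∧ x⁻¹ Δ ^ (sup x)`. -/
theorem preferredPrefix_eq (hΔ : S.Δ ≠ 1) (x : G) :
    S.preferredPrefix x =
      S.gcd (S.gcd (x * S.Δ ^ (-S.inf x)) S.Δ) (x⁻¹ * S.Δ ^ S.sup x) := by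
  refine S.eq_of_forall_le_iff fun c => ?_
  rw [preferredPrefix, initialFactor, initialFactor, inf_inv hΔ, neg_neg]
  simp only [le_gcd_iff]
  tauto

theorem le_inf_conj_iff (hΔ : S.Δ ≠ 1) (x g : G) (n : ℤ) :
    n ≤ S.inf (g⁻¹ * x * g) ↔ PrefixLE S.P g (x * g * S.Δ ^ (-n)) := by
  rw [← zpow_le_iff hΔ, ← S.mul_le_mul_left_iff g, ← S.mul_zpow_le_mul_zpow_iff (-n)]
  simp [mul_assoc]

theorem sup_conj_le_iff (hΔ : S.Δ ≠ 1) (x g : G) (n : ℤ) :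
    S.sup (g⁻¹ * x * g) ≤ n ↔ PrefixLE S.P g (x⁻¹ * g * S.Δ ^ n) := by
  rw [← le_zpow_iff hΔ, ← S.mul_le_mul_left_iff (x⁻¹ * g)]
  simp [mul_assoc]

/-! ### Meets of translates -/

variable (S) in
/-- The meet `a ∧ u a Δ ^ m` of `a` with its translate under the automorphism `a ↦ u a Δ ^ m` of
the prefix order. -/
noncomputable def meetTranslate (u : G) (m : ℤ) (a : G) : G := S.gcd a (u * a * S.Δ ^ m)

variable (S) in
theorem translate_le_iff (u : G) (m : ℤ) (a b : G) :
    PrefixLE S.P (u * a * S.Δ ^ m) (u * b * S.Δ ^ m) ↔ PrefixLE S.P a b := by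
  rw [mul_zpow_le_mul_zpow_iff, mul_le_mul_left_iff]

variable (S) in
theorem translate_gcd (u : G) (m : ℤ) (a b : G) :
    u * S.gcd a b * S.Δ ^ m = S.gcd (u * a * S.Δ ^ m) (u * b * S.Δ ^ m) := by
  rw [mul_gcd, gcd_mul_zpow]

/-- The elements lying below their image under one translation are closed under taking meets with
the image under a commuting translation. -/
theorem meetTranslate_le_translate {u v : G} (huv : Commute u v) (m n : ℤ) {a : G}
    (ha : PrefixLE S.P a (u * a * S.Δ ^ m)) :
    PrefixLE S.P (S.meetTranslate v n a) (u * S.meetTranslate v n a * S.Δ ^ m) := by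
  rw [meetTranslate, translate_gcd, le_gcd_iff]
  refine ⟨le_trans (S.gcd_le_left _ _) ha, le_trans (S.gcd_le_right _ _) ?_⟩
  have h := (S.translate_le_iff v n _ _).2 ha
  have e : u * (v * a * S.Δ ^ n) * S.Δ ^ m = v * (u * a * S.Δ ^ m) * S.Δ ^ n := by
    simp only [mul_assoc, ← zpow_add, add_comm m n]
    rw [← mul_assoc, ← mul_assoc v, huv.eq]
  rwa [e]

theorem iterate_meetTranslate_le_translate {u v : G} (huv : Commute u v) (m n : ℤ) {a : G}
    (ha : PrefixLE S.P a (u * a * S.Δ ^ m)) (k : ℕ) :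
    PrefixLE S.P ((S.meetTranslate v n)^[k] a) (u * (S.meetTranslate v n)^[k] a * S.Δ ^ m) := by
  induction k with
  | zero => exact ha
  | succ k ih =>
    rw [Function.iterate_succ_apply']
    exact meetTranslate_le_translate huv m n ih

variable (S) in
theorem meetTranslate_comm {u v : G} (huv : Commute u v) (m n : ℤ) :
    Function.Commute (S.meetTranslate u m) (S.meetTranslate v n) := by
  intro a
  refine S.eq_of_forall_le_iff fun c => ?_
  have e : u * (v * a * S.Δ ^ n) * S.Δ ^ m = v * (u * a * S.Δ ^ m) * S.Δ ^ n := by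
    simp only [mul_assoc, ← zpow_add, add_comm m n]
    rw [← mul_assoc, ← mul_assoc v, huv.eq]
  simp only [meetTranslate, translate_gcd, le_gcd_iff, e]
  tauto

/-! ### Consequences of finite type -/

theorem FiniteType.finite_one_pow (hS : S.FiniteType) (n : ℕ) :
    {a : G | PrefixLE S.P 1 a ∧ PrefixLE S.P a (S.Δ ^ n)}.Finite := by
  induction n with
  | zero =>
    refine (Set.finite_singleton (1 : G)).subset fun a ha => ?_
    exact le_antisymm (by simpa using ha.2) ha.1
  | succ n ih =>
    refine (Set.Finite.image2 (· * ·) hS ih).subset fun a ha => ?_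
    have h := S.le_gcd_mul_zpow (w := a) (k := n) (by positivity) (by exact_mod_cast ha.2)
    refine ⟨S.gcd a S.Δ, ⟨(S.le_gcd_iff _ _ _).2 ⟨ha.1, (S.one_le_iff _).2 S.Δ_mem⟩,
      S.gcd_le_right _ _⟩, (S.gcd a S.Δ)⁻¹ * a, ⟨?_, ?_⟩, by simp⟩
    · simpa using (S.mul_le_mul_left_iff (S.gcd a S.Δ)⁻¹ _ _).2 (S.gcd_le_left a S.Δ)
    · simpa using (S.mul_le_mul_left_iff (S.gcd a S.Δ)⁻¹ _ _).2 h

theorem FiniteType.finite_zpow_zpow (hS : S.FiniteType) (p q : ℤ) :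
    {a : G | PrefixLE S.P (S.Δ ^ p) a ∧ PrefixLE S.P a (S.Δ ^ q)}.Finite := by
  refine ((hS.finite_one_pow (q - p).toNat).image (S.Δ ^ p * ·)).subset fun a ha => ?_
  refine ⟨(S.Δ ^ p)⁻¹ * a, ⟨?_, ?_⟩, by simp⟩
  · simpa using (S.mul_le_mul_left_iff (S.Δ ^ p)⁻¹ _ _).2 ha.1
  · rw [← zpow_natCast]
    refine le_trans ?_ (S.zpow_le_zpow (Int.self_le_toNat _))
    rw [sub_eq_neg_add, zpow_add, zpow_neg]
    exact (S.mul_le_mul_left_iff (S.Δ ^ p)⁻¹ _ _).2 ha.2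

/-- Some positive power of `Δ` is central: conjugation by `Δ` permutes the simple elements. -/
theorem FiniteType.exists_pow_central (hS : S.FiniteType) :
    ∃ n : ℕ, 1 ≤ n ∧ ∀ g : G, Commute (S.Δ ^ n) g := by
  have : Finite S.simples := hS
  have hmem : ∀ s ∈ S.simples, S.Δ⁻¹ * s * S.Δ ∈ S.simples := by
    intro s hs
    constructor
    · simpa [PrefixLE, S.conj_mem_iff] using hs.1
    · have := hs.2
      rw [PrefixLE, ← S.conj_mem_iff] at this
      simpa [PrefixLE, mul_assoc] using this
  let τ : S.simples → S.simples := fun s => ⟨_, hmem s s.2⟩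
  have hτ : Function.Injective τ := fun s t h => by
    simpa [τ, Subtype.ext_iff] using h
  have hτn : ∀ (n : ℕ) (s : S.simples),
      ((τ^[n] s : S.simples) : G) = (S.Δ ^ n)⁻¹ * s * S.Δ ^ n := by
    intro n
    induction n with
    | zero => simp
    | succ n ih =>
      intro s
      rw [Function.iterate_succ_apply, ih, pow_succ']
      simp [τ, mul_assoc]
  obtain ⟨n, hn, h⟩ := isOfFinOrder_iff_pow_eq_one.1
    (isOfFinOrder_of_finite (Equiv.ofBijective τ (Finite.injective_iff_bijective.1 hτ)))
  have hfix : ∀ s, τ^[n] s = s := fun s => by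
    have := DFunLike.congr_fun h s
    rwa [← Equiv.Perm.iterate_eq_pow] at this
  refine ⟨n, hn, fun g => ?_⟩
  have hg : g ∈ Subgroup.closure {s : G | PrefixLE S.P 1 s ∧ PrefixLE S.P s S.Δ} := by
    rw [S.closure_simples]; trivial
  induction hg using Subgroup.closure_induction with
  | mem s hs =>
    have := hτn n ⟨s, hs⟩
    rw [hfix, mul_assoc, eq_inv_mul_iff_mul_eq] at this
    exact this
  | one => exact Commute.one_right _
  | mul a b _ _ ha hb => exact ha.mul_right hb
  | inv a _ ha => exact ha.inv_right

/-- If some element lies below its translate by `a ↦ u a Δ ^ m`, then so does one of the iterated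
meets `1 ∧ A 1 ∧ ⋯ ∧ A ^ k 1` of `1` with its translates: they decrease and are bounded below, so
they become stationary. -/
theorem FiniteType.exists_iterate_meetTranslate_le (hS : S.FiniteType) {u : G} {m : ℤ} {a : G}
    (ha : PrefixLE S.P a (u * a * S.Δ ^ m)) :
    ∃ k : ℕ, PrefixLE S.P ((S.meetTranslate u m)^[k] 1)
      (u * (S.meetTranslate u m)^[k] 1 * S.Δ ^ m) := by
  set F := S.meetTranslate u m with hF
  obtain ⟨p, q, hp, hq⟩ := S.exists_zpow_bounds a
  -- shifting `a` by a power of `Δ`, it becomes a lower bound of all the iterated meets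
  have hb : PrefixLE S.P (a * S.Δ ^ (-q)) (u * (a * S.Δ ^ (-q)) * S.Δ ^ m) := by
    have := (S.mul_zpow_le_mul_zpow_iff (-q) _ _).2 ha
    simpa only [mul_assoc, ← zpow_add, add_comm m (-q)] using this
  have hlow : ∀ k : ℕ, PrefixLE S.P (a * S.Δ ^ (-q)) (F^[k] 1) := by
    intro k
    induction k with
    | zero => simpa using (S.mul_zpow_le_mul_zpow_iff (-q) _ _).2 hq
    | succ k ih =>
      rw [Function.iterate_succ_apply', hF, meetTranslate, le_gcd_iff]
      exact ⟨ih, le_trans hb ((S.translate_le_iff u m _ _).2 ih)⟩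
  have hdec : ∀ j k : ℕ, PrefixLE S.P (F^[k + j] 1) (F^[k] 1) := by
    intro j k
    induction j with
    | zero => exact S.le_refl _
    | succ j ih =>
      rw [← add_assoc, Function.iterate_succ_apply']
      exact le_trans (S.gcd_le_left _ _) ih
  have hmem : ∀ k : ℕ, F^[k] 1 ∈
      {b : G | PrefixLE S.P (S.Δ ^ (p + -q)) b ∧ PrefixLE S.P b (S.Δ ^ (0 : ℤ))} := by
    refine fun k => ⟨le_trans ?_ (hlow k), by simpa using hdec k 0⟩
    rw [zpow_add]
    exact (S.mul_zpow_le_mul_zpow_iff (-q) _ _).2 hp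
  obtain ⟨i, j, hij, h⟩ := (hS.finite_zpow_zpow _ _).exists_lt_map_eq_of_forall_mem hmem
  refine ⟨i, ?_⟩
  obtain ⟨d, rfl⟩ : ∃ d, j = i + 1 + d := ⟨j - (i + 1), by omega⟩
  have h1 := hdec d (i + 1)
  rw [← h, Function.iterate_succ_apply'] at h1
  exact le_trans h1 (S.gcd_le_right _ _)

end GarsideStructure

namespace GarsideStructure

variable {G : Type*} [Group G] {S : GarsideStructure G}

/-! ### Cycling, decycling and sliding along a conjugacy class -/

theorem le_inf_conj_mul_zpow_iff (hΔ : S.Δ ≠ 1) (x b : G) (k n : ℤ) :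
    n ≤ S.inf ((b * S.Δ ^ k)⁻¹ * x * (b * S.Δ ^ k)) ↔ PrefixLE S.P b (x * b * S.Δ ^ (-n)) := by
  rw [le_inf_conj_iff hΔ, ← S.mul_zpow_le_mul_zpow_iff k b]
  simp only [mul_assoc, ← zpow_add, add_comm k]

theorem sup_conj_mul_zpow_le_iff (hΔ : S.Δ ≠ 1) (x b : G) (k n : ℤ) :
    S.sup ((b * S.Δ ^ k)⁻¹ * x * (b * S.Δ ^ k)) ≤ n ↔ PrefixLE S.P b (x⁻¹ * b * S.Δ ^ n) := by
  rw [sup_conj_le_iff hΔ, ← S.mul_zpow_le_mul_zpow_iff k b]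
  simp only [mul_assoc, ← zpow_add, add_comm k]

theorem cycling_conj (hΔ : S.Δ ≠ 1) (x b : G) (k : ℤ) {p : ℤ}
    (hp : S.inf ((b * S.Δ ^ k)⁻¹ * x * (b * S.Δ ^ k)) = p) :
    S.cycling ((b * S.Δ ^ k)⁻¹ * x * (b * S.Δ ^ k)) =
      (S.meetTranslate x (-(p + 1)) b * S.Δ ^ (k + 1))⁻¹ * x *
        (S.meetTranslate x (-(p + 1)) b * S.Δ ^ (k + 1)) := by
  have h : S.meetTranslate x (-(p + 1)) b * S.Δ ^ (k + 1) =
      (b * S.Δ ^ k) * S.gcd ((b * S.Δ ^ k)⁻¹ * x * (b * S.Δ ^ k) * S.Δ ^ (-p)) S.Δ := by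
    rw [meetTranslate, gcd_mul_zpow, mul_gcd, gcd_comm]
    congr 1
    · simp only [mul_assoc, mul_inv_cancel_left, ← zpow_add, mul_inv_rev]
      congr 3
      ring
    · rw [zpow_add_one, mul_assoc]
  rw [cycling_eq hΔ, hp, h]
  group

theorem decycling_conj (hΔ : S.Δ ≠ 1) (x b : G) (k : ℤ) {q : ℤ}
    (hq : S.sup ((b * S.Δ ^ k)⁻¹ * x * (b * S.Δ ^ k)) = q) :
    S.decycling ((b * S.Δ ^ k)⁻¹ * x * (b * S.Δ ^ k)) =
      (S.meetTranslate x⁻¹ (q - 1) b * S.Δ ^ k)⁻¹ * x *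
        (S.meetTranslate x⁻¹ (q - 1) b * S.Δ ^ k) := by
  have h : S.meetTranslate x⁻¹ (q - 1) b * S.Δ ^ k =
      (b * S.Δ ^ k) * S.gcd 1 (((b * S.Δ ^ k)⁻¹ * x * (b * S.Δ ^ k))⁻¹ * S.Δ ^ (q - 1)) := by
    rw [meetTranslate, gcd_mul_zpow, mul_gcd, mul_one]
    congr 1
    simp only [mul_assoc, mul_inv_cancel_left, ← zpow_add, mul_inv_rev, inv_inv, add_comm k]
  rw [decycling_eq hΔ, hq, h]
  group

/-- For canonical length at least `2`, the element conjugating to the cyclic sliding is the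
composite of the elements conjugating to the decycling and to the cycling: the extra term in the
iterated meet is a positive power of `Δ`. -/
theorem cyclicSliding_conj (hΔ : S.Δ ≠ 1) (x b : G) (k : ℤ) {p q : ℤ} (hpq : p + 2 ≤ q)
    (hp : S.inf ((b * S.Δ ^ k)⁻¹ * x * (b * S.Δ ^ k)) = p)
    (hq : S.sup ((b * S.Δ ^ k)⁻¹ * x * (b * S.Δ ^ k)) = q) :
    S.cyclicSliding ((b * S.Δ ^ k)⁻¹ * x * (b * S.Δ ^ k)) =
      (S.meetTranslate x (-(p + 1)) (S.meetTranslate x⁻¹ (q - 1) b) * S.Δ ^ (k + 1))⁻¹ * x *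
        (S.meetTranslate x (-(p + 1)) (S.meetTranslate x⁻¹ (q - 1) b) * S.Δ ^ (k + 1)) := by
  have h : S.meetTranslate x (-(p + 1)) (S.meetTranslate x⁻¹ (q - 1) b) * S.Δ ^ (k + 1) =
      (b * S.Δ ^ k) * S.preferredPrefix ((b * S.Δ ^ k)⁻¹ * x * (b * S.Δ ^ k)) := by
    rw [preferredPrefix_eq hΔ, hp, hq]
    simp only [meetTranslate, gcd_mul_zpow, mul_gcd]
    have e₁ : x * b * S.Δ ^ (-(p + 1)) * S.Δ ^ (k + 1) =
        b * S.Δ ^ k * ((b * S.Δ ^ k)⁻¹ * x * (b * S.Δ ^ k) * S.Δ ^ (-p)) := by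
      simp only [mul_assoc, mul_inv_cancel_left, ← zpow_add, mul_inv_rev]
      congr 3
      ring
    have e₂ : x⁻¹ * b * S.Δ ^ (q - 1) * S.Δ ^ (k + 1) =
        b * S.Δ ^ k * (((b * S.Δ ^ k)⁻¹ * x * (b * S.Δ ^ k))⁻¹ * S.Δ ^ q) := by
      simp only [mul_assoc, mul_inv_cancel_left, ← zpow_add, mul_inv_rev, inv_inv]
      congr 3
      ring
    have e₃ : x * (x⁻¹ * b * S.Δ ^ (q - 1)) * S.Δ ^ (-(p + 1)) * S.Δ ^ (k + 1) =
        b * S.Δ ^ (k + 1) * S.Δ ^ (q - p - 2) := by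
      simp only [mul_assoc, mul_inv_cancel_left, ← zpow_add]
      congr 2
      ring
    have e₄ : b * S.Δ ^ k * S.Δ = b * S.Δ ^ (k + 1) := by rw [zpow_add_one, mul_assoc]
    rw [e₁, e₂, e₃, e₄]
    refine S.eq_of_forall_le_iff fun c => ?_
    simp only [le_gcd_iff]
    have h₃ : PrefixLE S.P c (b * S.Δ ^ (k + 1)) →
        PrefixLE S.P c (b * S.Δ ^ (k + 1) * S.Δ ^ (q - p - 2)) := fun h =>
      le_trans h (S.le_mul_zpow _ (by omega))
    tauto
  rw [cyclicSliding, h]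
  group

theorem le_translate_inf (hΔ : S.Δ ≠ 1) (x : G) :
    PrefixLE S.P 1 (x * 1 * S.Δ ^ (-S.inf x)) := by
  have := (le_inf_conj_iff hΔ x 1 (S.inf x)).1 (by simp)
  exact this

theorem le_translate_sup (hΔ : S.Δ ≠ 1) (x : G) :
    PrefixLE S.P 1 (x⁻¹ * 1 * S.Δ ^ S.sup x) := by
  have := (sup_conj_le_iff hΔ x 1 (S.sup x)).1 (by simp)
  exact this

theorem inf_le_inf_cycling (hΔ : S.Δ ≠ 1) (x : G) : S.inf x ≤ S.inf (S.cycling x) := by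
  have h := cycling_conj hΔ x 1 0 (p := S.inf x) (by simp)
  rw [zpow_zero, mul_one, inv_one, one_mul, mul_one] at h
  rw [h, le_inf_conj_mul_zpow_iff hΔ]
  exact meetTranslate_le_translate (Commute.refl x) _ _ (le_translate_inf hΔ x)

theorem sup_cycling_le_sup (hΔ : S.Δ ≠ 1) (x : G) : S.sup (S.cycling x) ≤ S.sup x := by
  have h := cycling_conj hΔ x 1 0 (p := S.inf x) (by simp)
  rw [zpow_zero, mul_one, inv_one, one_mul, mul_one] at h
  rw [h, sup_conj_mul_zpow_le_iff hΔ]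
  exact meetTranslate_le_translate (Commute.refl x).inv_left _ _ (le_translate_sup hΔ x)

theorem inf_le_inf_decycling (hΔ : S.Δ ≠ 1) (x : G) : S.inf x ≤ S.inf (S.decycling x) := by
  have h := decycling_conj hΔ x 1 0 (q := S.sup x) (by simp)
  simp only [zpow_zero, mul_one, inv_one, one_mul] at h
  rw [h, le_inf_conj_iff hΔ]
  exact meetTranslate_le_translate (Commute.refl x).inv_right _ _ (le_translate_inf hΔ x)

theorem sup_decycling_le_sup (hΔ : S.Δ ≠ 1) (x : G) : S.sup (S.decycling x) ≤ S.sup x := by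
  have h := decycling_conj hΔ x 1 0 (q := S.sup x) (by simp)
  simp only [zpow_zero, mul_one, inv_one, one_mul] at h
  rw [h, sup_conj_le_iff hΔ]
  exact meetTranslate_le_translate (Commute.refl _) _ _ (le_translate_sup hΔ x)

theorem gcd_le_translate {u : G} {m : ℤ} {a b : G} (ha : PrefixLE S.P a (u * a * S.Δ ^ m))
    (hb : PrefixLE S.P b (u * b * S.Δ ^ m)) :
    PrefixLE S.P (S.gcd a b) (u * S.gcd a b * S.Δ ^ m) := by
  rw [translate_gcd, le_gcd_iff]
  exact ⟨le_trans (S.gcd_le_left _ _) ha, le_trans (S.gcd_le_right _ _) hb⟩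

/-- The elements lying below their translate are closed under commuting translations. -/
theorem translate_le_translate {u v : G} (huv : Commute u v) {m : ℤ} (n : ℤ) {a : G}
    (ha : PrefixLE S.P a (u * a * S.Δ ^ m)) :
    PrefixLE S.P (v * a * S.Δ ^ n) (u * (v * a * S.Δ ^ n) * S.Δ ^ m) := by
  have e : u * (v * a * S.Δ ^ n) * S.Δ ^ m = v * (u * a * S.Δ ^ m) * S.Δ ^ n := by
    simp only [mul_assoc, ← zpow_add, add_comm m n]
    rw [← mul_assoc, ← mul_assoc v, huv.eq]
  rw [e]
  exact (S.translate_le_iff v n _ _).2 ha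

/-- An inequality `1 ≼ u Δ ^ m` for `u` commuting with `x` passes to the preferred prefix. -/
theorem preferredPrefix_le_translate (hΔ : S.Δ ≠ 1) (x : G) {u : G} (hu : Commute u x) {m : ℤ}
    (h : PrefixLE S.P 1 (u * 1 * S.Δ ^ m)) :
    PrefixLE S.P (S.preferredPrefix x) (u * S.preferredPrefix x * S.Δ ^ m) := by
  rw [preferredPrefix_eq hΔ]
  refine gcd_le_translate (gcd_le_translate ?_ ?_) ?_
  · simpa using translate_le_translate hu (-S.inf x) h
  · simpa using translate_le_translate (Commute.one_right u) 1 h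
  · simpa using translate_le_translate hu.inv_right (S.sup x) h

theorem inf_le_inf_cyclicSliding (hΔ : S.Δ ≠ 1) (x : G) :
    S.inf x ≤ S.inf (S.cyclicSliding x) := by
  rw [cyclicSliding, le_inf_conj_iff hΔ]
  exact preferredPrefix_le_translate hΔ x (Commute.refl x) (le_translate_inf hΔ x)

theorem sup_cyclicSliding_le_sup (hΔ : S.Δ ≠ 1) (x : G) :
    S.sup (S.cyclicSliding x) ≤ S.sup x := by
  rw [cyclicSliding, sup_conj_le_iff hΔ]
  exact preferredPrefix_le_translate hΔ x (Commute.refl x).inv_left (le_translate_sup hΔ x)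

/-! ### Periodic elements have maximal infimum and minimal supremum -/

/-- A quantity that never decreases along an orbit is constant along a periodic orbit. -/
theorem eq_of_iterate_eq {α : Type*} {f : α → α} {φ : α → ℤ} (hφ : ∀ z, φ z ≤ φ (f z)) {y : α}
    {m : ℕ} (hm : 1 ≤ m) (hy : f^[m] y = y) (k : ℕ) : φ (f^[k] y) = φ y := by
  have hmono : Monotone fun k => φ (f^[k] y) := monotone_nat_of_le_succ fun k => by
    rw [Function.iterate_succ_apply']
    exact hφ _
  have h₁ : φ y ≤ φ (f^[k] y) := hmono (Nat.zero_le k)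
  have h₂ : φ (f^[k] y) ≤ φ (f^[m * k] y) := hmono (Nat.le_mul_of_pos_left k hm)
  rw [Function.iterate_mul, Function.iterate_fixed hy] at h₂
  omega

/-- If some iterated cycling does not change `y`, then `y` has maximal infimum in its class:
iterated cycling conjugates by the meets `1 ∧ A 1 ∧ ⋯ ∧ A ^ k 1` up to powers of `Δ`, where
`A a = y a Δ ^ (-inf y - 1)`, and a stationary meet conjugates `y` to an element of larger
infimum. -/
theorem inf_conj_le_of_iterate_cycling_eq (hΔ : S.Δ ≠ 1) (hS : S.FiniteType) {y : G} {m : ℕ}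
    (hm : 1 ≤ m) (hy : S.cycling^[m] y = y) (g : G) : S.inf (g⁻¹ * y * g) ≤ S.inf y := by
  have hconst := eq_of_iterate_eq (inf_le_inf_cycling hΔ) hm hy
  set F := S.meetTranslate y (-(S.inf y + 1)) with hF
  have horb : ∀ k : ℕ, S.cycling^[k] y =
      (F^[k] 1 * S.Δ ^ (k : ℤ))⁻¹ * y * (F^[k] 1 * S.Δ ^ (k : ℤ)) := by
    intro k
    induction k with
    | zero => simp
    | succ k ih =>
      have h := hconst k
      rw [ih] at h
      rw [Function.iterate_succ_apply', ih, cycling_conj hΔ _ _ _ h, Function.iterate_succ_apply',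
        Nat.cast_succ]
  by_contra hlt
  obtain ⟨k, hk⟩ := hS.exists_iterate_meetTranslate_le
    ((le_inf_conj_iff hΔ y g (S.inf y + 1)).1 (by omega))
  have h := (le_inf_conj_mul_zpow_iff hΔ y _ k _).2 hk
  rw [← hF, ← horb k, hconst k] at h
  omega

/-- If some iterated decycling does not change `y`, then `y` has minimal supremum in its class. -/
theorem sup_le_conj_of_iterate_decycling_eq (hΔ : S.Δ ≠ 1) (hS : S.FiniteType) {y : G} {m : ℕ}
    (hm : 1 ≤ m) (hy : S.decycling^[m] y = y) (g : G) : S.sup y ≤ S.sup (g⁻¹ * y * g) := by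
  have hconst : ∀ k, S.sup (S.decycling^[k] y) = S.sup y := fun k => neg_injective
    (eq_of_iterate_eq (φ := fun z => -S.sup z)
      (fun z => neg_le_neg (sup_decycling_le_sup hΔ z)) hm hy k)
  set F := S.meetTranslate y⁻¹ (S.sup y - 1) with hF
  have horb : ∀ k : ℕ, S.decycling^[k] y =
      (F^[k] 1 * S.Δ ^ (0 : ℤ))⁻¹ * y * (F^[k] 1 * S.Δ ^ (0 : ℤ)) := by
    intro k
    induction k with
    | zero => simp
    | succ k ih =>
      have h := hconst k
      rw [ih] at h
      rw [Function.iterate_succ_apply', ih, decycling_conj hΔ _ _ _ h,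
        Function.iterate_succ_apply']
  by_contra hlt
  obtain ⟨k, hk⟩ := hS.exists_iterate_meetTranslate_le
    ((sup_conj_le_iff hΔ y g (S.sup y - 1)).1 (by omega))
  have h := (sup_conj_mul_zpow_le_iff hΔ y _ 0 _).2 hk
  rw [← hF, ← horb k, hconst k] at h
  omega

/-- If some iterated cyclic sliding does not change `y` and `y` has canonical length at least `2`,
then `y` has maximal infimum and minimal supremum in its class. Iterated sliding conjugates by
`F_A ^ k (F_B ^ k 1)`, where `F_A` and `F_B` are the commuting operators governing cycling and
decycling; one of them makes the element lie below its translate and the other one preserves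
this. -/
theorem isExtremal_of_iterate_cyclicSliding_eq (hΔ : S.Δ ≠ 1) (hS : S.FiniteType) {y : G} {m : ℕ}
    (hm : 1 ≤ m) (hy : S.cyclicSliding^[m] y = y) (hlen : 2 ≤ S.len y) (g : G) :
    S.inf (g⁻¹ * y * g) ≤ S.inf y ∧ S.sup y ≤ S.sup (g⁻¹ * y * g) := by
  have hinf := eq_of_iterate_eq (inf_le_inf_cyclicSliding hΔ) hm hy
  have hsup : ∀ k, S.sup (S.cyclicSliding^[k] y) = S.sup y := fun k => neg_injective
    (eq_of_iterate_eq (φ := fun z => -S.sup z)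
      (fun z => neg_le_neg (sup_cyclicSliding_le_sup hΔ z)) hm hy k)
  have hpq : S.inf y + 2 ≤ S.sup y := by
    have := S.sup_sub_inf y
    omega
  set A := S.meetTranslate y (-(S.inf y + 1)) with hA
  set B := S.meetTranslate y⁻¹ (S.sup y - 1) with hB
  have hAB : Function.Commute A B := S.meetTranslate_comm (Commute.refl y).inv_right _ _
  have horb : ∀ k : ℕ, S.cyclicSliding^[k] y =
      ((A ∘ B)^[k] 1 * S.Δ ^ (k : ℤ))⁻¹ * y * ((A ∘ B)^[k] 1 * S.Δ ^ (k : ℤ)) := by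
    intro k
    induction k with
    | zero => simp
    | succ k ih =>
      have h₁ := hinf k
      have h₂ := hsup k
      rw [ih] at h₁ h₂
      rw [Function.iterate_succ_apply', ih, cyclicSliding_conj hΔ _ _ _ hpq h₁ h₂,
        Function.iterate_succ_apply', Nat.cast_succ]
      rfl
  constructor
  · by_contra hlt
    obtain ⟨k, hk⟩ := hS.exists_iterate_meetTranslate_le
      ((le_inf_conj_iff hΔ y g (S.inf y + 1)).1 (by omega))
    have hk' := iterate_meetTranslate_le_translate (Commute.refl y).inv_right _ (S.sup y - 1) hk k
    rw [← hA, ← hB, ← Function.comp_apply (f := B^[k]), ← hAB.symm.comp_iterate,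
      ← hAB.comp_eq] at hk'
    have h := (le_inf_conj_mul_zpow_iff hΔ y _ k _).2 hk'
    rw [← horb k, hinf k] at h
    omega
  · by_contra hlt
    obtain ⟨k, hk⟩ := hS.exists_iterate_meetTranslate_le
      ((sup_conj_le_iff hΔ y g (S.sup y - 1)).1 (by omega))
    have hk' := iterate_meetTranslate_le_translate (Commute.refl y).inv_left _
      (-(S.inf y + 1)) hk k
    rw [← hA, ← hB, ← Function.comp_apply (f := A^[k]), ← hAB.comp_iterate] at hk'
    have h := (sup_conj_mul_zpow_le_iff hΔ y _ k _).2 hk'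
    rw [← horb k, hsup k] at h
    omega

end GarsideStructure

namespace GarsideStructure

variable {G : Type*} [Group G] {S : GarsideStructure G}

/-! ### The super summit set -/

theorem mem_conjugatesOf_iff {x y : G} : y ∈ conjugatesOf x ↔ ∃ g, y = g⁻¹ * x * g := by
  change IsConj x y ↔ _
  rw [isConj_iff]
  constructor
  · rintro ⟨c, rfl⟩
    exact ⟨c⁻¹, by simp⟩
  · rintro ⟨g, rfl⟩
    exact ⟨g⁻¹, by simp⟩

theorem conj_mem_conjugatesOf {x y : G} (hy : y ∈ conjugatesOf x) (g : G) :
    g⁻¹ * y * g ∈ conjugatesOf x := by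
  obtain ⟨h, rfl⟩ := mem_conjugatesOf_iff.1 hy
  exact mem_conjugatesOf_iff.2 ⟨h * g, by group⟩

theorem exists_conj_eq {x y z : G} (hy : y ∈ conjugatesOf x) (hz : z ∈ conjugatesOf x) :
    ∃ g, z = g⁻¹ * y * g := by
  obtain ⟨h, rfl⟩ := mem_conjugatesOf_iff.1 hy
  obtain ⟨k, rfl⟩ := mem_conjugatesOf_iff.1 hz
  exact ⟨h⁻¹ * k, by group⟩

/-- An element of minimal canonical length has maximal infimum: otherwise a stationary meet of
translates conjugates it to an element of larger infimum whose supremum is not larger. -/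
theorem inf_le_of_mem_SSS (hΔ : S.Δ ≠ 1) (hS : S.FiniteType) {x y z : G} (hy : y ∈ S.SSS x)
    (hz : z ∈ conjugatesOf x) : S.inf z ≤ S.inf y := by
  by_contra hlt
  obtain ⟨g, rfl⟩ := exists_conj_eq hy.1 hz
  obtain ⟨k, hk⟩ := hS.exists_iterate_meetTranslate_le
    ((le_inf_conj_iff hΔ y g (S.inf y + 1)).1 (by omega))
  have h₁ := (le_inf_conj_iff hΔ y _ _).2 hk
  have h₂ := (sup_conj_le_iff hΔ y _ _).2 (iterate_meetTranslate_le_translate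
    (Commute.refl y).inv_left _ (-(S.inf y + 1)) (le_translate_sup hΔ y) k)
  have h₃ := hy.2 _ (conj_mem_conjugatesOf hy.1 ((S.meetTranslate y (-(S.inf y + 1)))^[k] 1))
  have h₄ := S.sup_sub_inf y
  have h₅ := S.sup_sub_inf (((S.meetTranslate y (-(S.inf y + 1)))^[k] 1)⁻¹ * y *
    (S.meetTranslate y (-(S.inf y + 1)))^[k] 1)
  omega

theorem sup_le_of_mem_SSS (hΔ : S.Δ ≠ 1) (hS : S.FiniteType) {x y z : G} (hy : y ∈ S.SSS x)
    (hz : z ∈ conjugatesOf x) : S.sup y ≤ S.sup z := by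
  have h₁ := inf_le_of_mem_SSS hΔ hS hy hz
  by_contra hlt
  obtain ⟨g, rfl⟩ := exists_conj_eq hy.1 hz
  obtain ⟨k, hk⟩ := hS.exists_iterate_meetTranslate_le
    ((sup_conj_le_iff hΔ y g (S.sup y - 1)).1 (by omega))
  have h₁ := (sup_conj_le_iff hΔ y _ _).2 hk
  have h₂ := (le_inf_conj_iff hΔ y _ _).2 (iterate_meetTranslate_le_translate
    (Commute.refl y).inv_right _ (S.sup y - 1) (le_translate_inf hΔ y) k)
  have h₃ := hy.2 _ (conj_mem_conjugatesOf hy.1 ((S.meetTranslate y⁻¹ (S.sup y - 1))^[k] 1))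
  have h₄ := S.sup_sub_inf y
  have h₅ := S.sup_sub_inf (((S.meetTranslate y⁻¹ (S.sup y - 1))^[k] 1)⁻¹ * y *
    (S.meetTranslate y⁻¹ (S.sup y - 1))^[k] 1)
  omega

theorem mem_SSS_of_extremal {x y : G} (hy : y ∈ conjugatesOf x)
    (h : ∀ g, S.inf (g⁻¹ * y * g) ≤ S.inf y ∧ S.sup y ≤ S.sup (g⁻¹ * y * g)) : y ∈ S.SSS x := by
  refine ⟨hy, fun z hz => ?_⟩
  obtain ⟨g, rfl⟩ := exists_conj_eq hy hz
  have h₁ := S.sup_sub_inf y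
  have h₂ := S.sup_sub_inf (g⁻¹ * y * g)
  have h₃ := h g
  omega

theorem SSS_subset_SS (hΔ : S.Δ ≠ 1) (hS : S.FiniteType) (x : G) : S.SSS x ⊆ S.SS x :=
  fun _ hy => ⟨hy.1, fun _ hz => inf_le_of_mem_SSS hΔ hS hy hz⟩

theorem RSSS_subset_SSS (hΔ : S.Δ ≠ 1) (hS : S.FiniteType) (x : G) : S.RSSS x ⊆ S.SSS x := by
  rintro y ⟨hy, ⟨m, hm, hc⟩, ⟨n, hn, hd⟩⟩
  exact mem_SSS_of_extremal hy fun g => ⟨inf_conj_le_of_iterate_cycling_eq hΔ hS hm hc g,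
    sup_le_conj_of_iterate_decycling_eq hΔ hS hn hd g⟩

theorem len_eq_summitLen {x y : G} (hy : y ∈ S.SSS x) : S.len y = S.summitLen x := by
  refine Nat.le_antisymm ?_ (Nat.sInf_le ⟨y, hy.1, rfl⟩)
  obtain ⟨z, hz, h⟩ := Nat.sInf_mem (s := S.len '' conjugatesOf x) ⟨_, y, hy.1, rfl⟩
  rw [summitLen, ← h]
  exact hy.2 z hz

variable (S) in
theorem SSS_nonempty (x : G) : (S.SSS x).Nonempty := by
  obtain ⟨y, hy, h⟩ := Nat.sInf_mem (s := S.len '' conjugatesOf x)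
    ⟨_, x, mem_conjugatesOf_self, rfl⟩
  refine ⟨y, hy, fun z hz => ?_⟩
  rw [h]
  exact Nat.sInf_le ⟨z, hz, rfl⟩

/-! ### Canonical length at most one -/

theorem zpow_mul_le_pow {y : G} {p : ℤ} (h : PrefixLE S.P (S.Δ ^ p) y) (n : ℕ) :
    PrefixLE S.P (S.Δ ^ (p * n)) (y ^ n) := by
  induction n with
  | zero => simpa using S.le_refl 1
  | succ n ih =>
    rw [pow_succ, Nat.cast_succ, mul_add_one]
    exact zpow_add_le_mul ih h

theorem pow_le_zpow_mul {y : G} {p : ℤ} (h : PrefixLE S.P y (S.Δ ^ p)) (n : ℕ) :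
    PrefixLE S.P (y ^ n) (S.Δ ^ (p * n)) := by
  induction n with
  | zero => simpa using S.le_refl 1
  | succ n ih =>
    rw [pow_succ, Nat.cast_succ, mul_add_one]
    exact mul_le_zpow_add ih h

/-- An element of canonical length at most `1` that is conjugate to a power of `Δ` is that power
of `Δ`: for `Δ ^ N` central one has `y ^ N = Δ ^ (k N)`, and this forces equality in
`Δ ^ (p N) ≼ y ^ N ≼ Δ ^ (q N)` on one side. -/
theorem eq_zpow_of_conj_eq_zpow (hΔ : S.Δ ≠ 1) (hS : S.FiniteType) {y g : G} {k : ℤ}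
    (h : g⁻¹ * y * g = S.Δ ^ k) (hlen : S.len y ≤ 1) : y = S.Δ ^ k := by
  obtain ⟨N, hN, hcen⟩ := hS.exists_pow_central
  have hyg : y = g * S.Δ ^ k * g⁻¹ := by rw [← h]; group
  have hyN : y ^ N = S.Δ ^ (k * N) := by
    have hc : Commute ((S.Δ ^ N) ^ k) g := (hcen g).zpow_left k
    rw [hyg, conj_pow, ← zpow_natCast, ← zpow_mul, mul_comm k, zpow_mul, zpow_natCast, ← hc.eq,
      mul_inv_cancel_right]
  have hinf := zpow_inf_le hΔ y
  have hsup := le_zpow_sup hΔ y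
  have h₁ : S.inf y ≤ k := by
    have := zpow_mul_le_pow hinf N
    rw [hyN, zpow_le_zpow_iff hΔ] at this
    exact le_of_mul_le_mul_right this (by exact_mod_cast hN)
  have h₂ : k ≤ S.sup y := by
    have := pow_le_zpow_mul hsup N
    rw [hyN, zpow_le_zpow_iff hΔ] at this
    exact le_of_mul_le_mul_right this (by exact_mod_cast hN)
  have hlen' := S.sup_sub_inf y
  obtain ⟨n, rfl⟩ : ∃ n, N = n + 1 := ⟨N - 1, by omega⟩
  have hyN' : y ^ n * y = S.Δ ^ (k * n) * S.Δ ^ k := by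
    rw [← pow_succ, hyN, ← zpow_add, Nat.cast_succ, mul_add_one]
  rcases (show k = S.inf y ∨ k = S.sup y by omega) with hk | hk
  · rw [← hk] at hinf
    refine le_antisymm ?_ hinf
    rw [← S.mul_le_mul_left_iff (y ^ n), hyN']
    exact (S.mul_zpow_le_mul_zpow_iff k _ _).2 (zpow_mul_le_pow hinf n)
  · rw [← hk] at hsup
    refine le_antisymm hsup ?_
    rw [← S.mul_le_mul_left_iff (y ^ n), hyN']
    exact (S.mul_zpow_le_mul_zpow_iff k _ _).2 (pow_le_zpow_mul hsup n)

/-- Every element of canonical length at most `1` has minimal canonical length. -/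
theorem mem_SSS_of_len_le_one (hΔ : S.Δ ≠ 1) (hS : S.FiniteType) {x y : G}
    (hy : y ∈ conjugatesOf x) (hlen : S.len y ≤ 1) : y ∈ S.SSS x := by
  refine ⟨hy, fun z hz => ?_⟩
  by_contra hlt
  obtain ⟨g, rfl⟩ := exists_conj_eq hy hz
  have h0 : S.len (g⁻¹ * y * g) = 0 := by omega
  have h := eq_zpow_of_conj_eq_zpow hΔ hS (eq_zpow_of_len_eq_zero hΔ h0) hlen
  have h' := (eq_zpow_of_len_eq_zero hΔ h0).trans h.symm
  rw [h'] at hlt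
  exact hlt le_rfl

theorem inf_conj_zpow (hΔ : S.Δ ≠ 1) (x : G) (k : ℤ) :
    S.inf ((S.Δ ^ k)⁻¹ * x * S.Δ ^ k) = S.inf x := by
  refine _root_.eq_of_forall_le_iff fun n => ?_
  have h₁ := le_inf_conj_mul_zpow_iff hΔ x 1 k n
  have h₂ := le_inf_conj_iff hΔ x 1 n
  simp only [one_mul, inv_one, mul_one] at h₁ h₂
  rw [h₁, h₂]

theorem sup_conj_zpow (hΔ : S.Δ ≠ 1) (x : G) (k : ℤ) :
    S.sup ((S.Δ ^ k)⁻¹ * x * S.Δ ^ k) = S.sup x := by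
  refine eq_of_forall_ge_iff fun n => ?_
  have h₁ := sup_conj_mul_zpow_le_iff hΔ x 1 k n
  have h₂ := sup_conj_le_iff hΔ x 1 n
  simp only [one_mul, inv_one, mul_one] at h₁ h₂
  rw [h₁, h₂]

/-- A map that acts on the elements of given infimum and supremum as conjugation by a fixed power
of `Δ` is periodic on them. -/
theorem exists_iterate_eq_of_conj_zpow (hΔ : S.Δ ≠ 1) (hS : S.FiniteType) {f : G → G}
    {y : G} (j : ℤ)
    (hf : ∀ z, S.inf z = S.inf y → S.sup z = S.sup y → f z = (S.Δ ^ j)⁻¹ * z * S.Δ ^ j) :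
    ∃ m, 1 ≤ m ∧ f^[m] y = y := by
  obtain ⟨N, hN, hcen⟩ := hS.exists_pow_central
  have h : ∀ k : ℕ, f^[k] y = (S.Δ ^ (j * k))⁻¹ * y * S.Δ ^ (j * k) := by
    intro k
    induction k with
    | zero => simp
    | succ k ih =>
      rw [Function.iterate_succ_apply', ih, hf _ (inf_conj_zpow hΔ y _) (sup_conj_zpow hΔ y _),
        Nat.cast_succ, mul_add_one, zpow_add]
      simp only [mul_assoc, mul_inv_rev]
  refine ⟨N, hN, ?_⟩
  have hc : Commute ((S.Δ ^ N) ^ j) y := (hcen y).zpow_left j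
  rw [h N, mul_comm j, zpow_mul, zpow_natCast, mul_assoc, ← hc.eq, inv_mul_cancel_left]

theorem SSS_subset_RSSS_of_summitLen_le_one (hΔ : S.Δ ≠ 1) (hS : S.FiniteType) {x : G}
    (hx : S.summitLen x ≤ 1) : S.SSS x ⊆ S.RSSS x := by
  intro y hy
  rw [← len_eq_summitLen hy] at hx
  have hlen := S.sup_sub_inf y
  refine ⟨hy.1, exists_iterate_eq_of_conj_zpow hΔ hS (-S.inf y) fun z h₁ h₂ => ?_,
    exists_iterate_eq_of_conj_zpow hΔ hS (S.sup y - 1) fun z h₁ h₂ => ?_⟩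
  · have hle : PrefixLE S.P (z * S.Δ ^ (-S.inf y)) S.Δ := by
      rw [← S.mul_zpow_le_mul_zpow_iff (S.inf y), mul_assoc, ← zpow_add, neg_add_cancel,
        zpow_zero, mul_one, ← zpow_one_add, le_zpow_iff hΔ]
      omega
    rw [cycling_eq hΔ, h₁, gcd_eq_left hle]
    simp [mul_assoc]
  · have hle : PrefixLE S.P (z⁻¹ * S.Δ ^ (S.sup y - 1)) 1 := by
      rw [← S.mul_le_mul_left_iff z, mul_inv_cancel_left, mul_one, zpow_le_iff hΔ]
      omega
    rw [decycling_eq hΔ, h₂, gcd_comm, gcd_eq_left hle]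
    simp [mul_assoc]

theorem SC_subset_SSS (hΔ : S.Δ ≠ 1) (hS : S.FiniteType) (x : G) : S.SC x ⊆ S.SSS x := by
  rintro y ⟨hy, m, hm, h⟩
  by_cases hlen : S.len y ≤ 1
  · exact mem_SSS_of_len_le_one hΔ hS hy hlen
  · exact mem_SSS_of_extremal hy
      (isExtremal_of_iterate_cyclicSliding_eq hΔ hS hm h (by omega))

/-! ### Canonical length at least two -/

/-- If the composite of two commuting self-maps of a finite set is periodic at a point, then so is
each of them. -/
theorem exists_iterate_eq_of_comp {X : Type*} [Finite X] {f g : X → X} (h : Function.Commute f g)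
    {y : X} {m : ℕ} (hm : 1 ≤ m) (hy : (f ∘ g)^[m] y = y) : ∃ n, 1 ≤ n ∧ g^[n] y = y := by
  have hy' : ∀ k : ℕ, f^[m * k] (g^[m * k] y) = y := fun k => by
    have := h.comp_iterate (m * k)
    rw [← Function.comp_apply (f := f^[m * k]), ← this, Function.iterate_mul,
      Function.iterate_fixed hy]
  obtain ⟨i, j, hij, heq⟩ := Finite.exists_ne_map_eq_of_infinite fun k : ℕ => g^[m * k] y
  wlog hlt : i < j generalizing i j
  · exact this j i hij.symm heq.symm (by omega)
  obtain ⟨d, rfl⟩ := Nat.exists_eq_add_of_lt hlt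
  refine ⟨m * (d + 1), Nat.mul_pos hm (by omega), ?_⟩
  have heq' : g^[m * i] y = g^[m * (d + 1)] (g^[m * i] y) := by
    rw [← Function.iterate_add_apply, ← mul_add, add_comm (d + 1), ← add_assoc]
    exact heq
  calc g^[m * (d + 1)] y = g^[m * (d + 1)] (f^[m * i] (g^[m * i] y)) := by rw [hy']
    _ = f^[m * i] (g^[m * (d + 1)] (g^[m * i] y)) := ((h.iterate_iterate _ _) _).symm
    _ = y := by rw [← heq', hy']

theorem finite_SSS (hΔ : S.Δ ≠ 1) (hS : S.FiniteType) (x : G) : (S.SSS x).Finite := by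
  obtain ⟨y, hy⟩ := S.SSS_nonempty x
  refine (hS.finite_zpow_zpow (S.inf y) (S.sup y)).subset fun z hz => ⟨?_, ?_⟩
  · exact (zpow_le_iff hΔ z _).2 (inf_le_of_mem_SSS hΔ hS hz hy.1)
  · exact (le_zpow_iff hΔ z _).2 (sup_le_of_mem_SSS hΔ hS hz hy.1)

theorem mem_SSS_of_le {x y z : G} (hy : y ∈ S.SSS x) (hz : z ∈ conjugatesOf x)
    (h₁ : S.inf y ≤ S.inf z) (h₂ : S.sup z ≤ S.sup y) : z ∈ S.SSS x := by
  refine ⟨hz, fun w hw => _root_.le_trans ?_ (hy.2 w hw)⟩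
  have h₃ := S.sup_sub_inf y
  have h₄ := S.sup_sub_inf z
  omega

theorem cycling_mem_SSS (hΔ : S.Δ ≠ 1) {x y : G} (hy : y ∈ S.SSS x) : S.cycling y ∈ S.SSS x := by
  refine mem_SSS_of_le hy ?_ (inf_le_inf_cycling hΔ y) (sup_cycling_le_sup hΔ y)
  rw [cycling_eq hΔ]
  exact conj_mem_conjugatesOf hy.1 _

theorem decycling_mem_SSS (hΔ : S.Δ ≠ 1) {x y : G} (hy : y ∈ S.SSS x) :
    S.decycling y ∈ S.SSS x := by
  refine mem_SSS_of_le hy ?_ (inf_le_inf_decycling hΔ y) (sup_decycling_le_sup hΔ y)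
  rw [decycling_eq hΔ]
  exact conj_mem_conjugatesOf hy.1 _

/-- On a super summit set of canonical length at least `2`, cyclic sliding is the composite of
cycling and decycling, in either order. -/
theorem cyclicSliding_eq_of_mem_SSS (hΔ : S.Δ ≠ 1) (hS : S.FiniteType) {x y : G}
    (hx : 1 < S.summitLen x) (hy : y ∈ S.SSS x) :
    S.cyclicSliding y = S.cycling (S.decycling y) ∧
      S.cyclicSliding y = S.decycling (S.cycling y) := by
  have hpq : S.inf y + 2 ≤ S.sup y := by
    have := S.sup_sub_inf y
    rw [← len_eq_summitLen hy] at hx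
    omega
  have hinf : ∀ z ∈ S.SSS x, S.inf z = S.inf y := fun z hz =>
    _root_.le_antisymm (inf_le_of_mem_SSS hΔ hS hy hz.1) (inf_le_of_mem_SSS hΔ hS hz hy.1)
  have hsup : ∀ z ∈ S.SSS x, S.sup z = S.sup y := fun z hz =>
    _root_.le_antisymm (sup_le_of_mem_SSS hΔ hS hz hy.1) (sup_le_of_mem_SSS hΔ hS hy hz.1)
  have hy₁ : ((1 : G) * S.Δ ^ (0 : ℤ))⁻¹ * y * (1 * S.Δ ^ (0 : ℤ)) = y := by simp
  have hs := cyclicSliding_conj hΔ y 1 0 hpq (by rw [hy₁]) (by rw [hy₁])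
  have hc := cycling_conj hΔ y 1 0 (p := S.inf y) (by rw [hy₁])
  have hd := decycling_conj hΔ y 1 0 (q := S.sup y) (by rw [hy₁])
  rw [hy₁] at hs hc hd
  have hc' := hinf _ (decycling_mem_SSS hΔ hy)
  have hd' := hsup _ (cycling_mem_SSS hΔ hy)
  rw [hd] at hc'
  rw [hc] at hd'
  rw [hs, hc, hd, cycling_conj hΔ _ _ _ hc', decycling_conj hΔ _ _ _ hd',
    (S.meetTranslate_comm (Commute.refl y).inv_left _ _).eq]
  exact ⟨rfl, rfl⟩

theorem SC_eq_RSSS_of_one_lt_summitLen (hΔ : S.Δ ≠ 1) (hS : S.FiniteType) {x : G}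
    (hx : 1 < S.summitLen x) : S.SC x = S.RSSS x := by
  have hcm : Set.MapsTo S.cycling (S.SSS x) (S.SSS x) := fun _ => cycling_mem_SSS hΔ
  have hdm : Set.MapsTo S.decycling (S.SSS x) (S.SSS x) := fun _ => decycling_mem_SSS hΔ
  have hsm : Set.MapsTo S.cyclicSliding (S.SSS x) (S.SSS x) := fun y hy => by
    rw [(cyclicSliding_eq_of_mem_SSS hΔ hS hx hy).1]
    exact hcm (hdm hy)
  have : Finite (S.SSS x) := finite_SSS hΔ hS x
  set c := hcm.restrict with hc
  set d := hdm.restrict with hd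
  set s := hsm.restrict with hs
  have hscd : s = c ∘ d := funext fun y => Subtype.ext (cyclicSliding_eq_of_mem_SSS hΔ hS hx y.2).1
  have hsdc : s = d ∘ c := funext fun y => Subtype.ext (cyclicSliding_eq_of_mem_SSS hΔ hS hx y.2).2
  have hcomm : Function.Commute c d := fun y => congrFun (hscd.symm.trans hsdc) y
  have key : ∀ {f : G → G} (hf : Set.MapsTo f (S.SSS x) (S.SSS x)) (y : S.SSS x) (m : ℕ),
      hf.restrict^[m] y = y ↔ f^[m] y = y := by
    intro f hf y m
    rw [hf.iterate_restrict, Subtype.ext_iff, Set.MapsTo.val_restrict_apply]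
  ext y
  constructor
  · intro hy
    have hy' := SC_subset_SSS hΔ hS x hy
    obtain ⟨hyx, m, hm, h⟩ := hy
    have h' := (key hsm ⟨y, hy'⟩ m).2 h
    obtain ⟨n, hn, hd⟩ := exists_iterate_eq_of_comp hcomm hm (by rw [← hscd]; exact h')
    obtain ⟨k, hk, hc⟩ := exists_iterate_eq_of_comp hcomm.symm hm (by rw [← hsdc]; exact h')
    exact ⟨hyx, ⟨k, hk, (key hcm _ k).1 hc⟩, ⟨n, hn, (key hdm _ n).1 hd⟩⟩
  · intro hy
    have hy' := RSSS_subset_SSS hΔ hS x hy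
    obtain ⟨hyx, ⟨m, hm, h₁⟩, ⟨n, hn, h₂⟩⟩ := hy
    refine ⟨hyx, m * n, Nat.mul_pos hm hn, (key hsm ⟨y, hy'⟩ _).1 ?_⟩
    have h₁' := (key hcm ⟨y, hy'⟩ m).2 h₁
    have h₂' := (key hdm ⟨y, hy'⟩ n).2 h₂
    change s^[m * n] _ = _
    rw [hscd, hcomm.comp_iterate, Function.comp_apply, mul_comm m n, Function.iterate_mul d,
      Function.iterate_fixed h₂', mul_comm n m, Function.iterate_mul c, Function.iterate_fixed h₁']

theorem invariant_sets_of_finiteType (hS : S.FiniteType) (x : G) :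
    (S.SC x ⊆ S.RSSS x ∧ S.RSSS x ⊆ S.USS x ∧ S.USS x ⊆ S.SSS x ∧ S.SSS x ⊆ S.SS x) ∧
      (1 < S.summitLen x → S.SC x = S.RSSS x) ∧
      (S.summitLen x = 1 → S.SC x ⊆ S.RSSS x ∧ S.RSSS x = S.USS x ∧ S.USS x = S.SSS x) := by
  have hUSS : S.USS x ⊆ S.SSS x := fun y hy => hy.1
  -- in the trivial group `Δ = 1`, so normal forms are not unique, but all the sets are everything
  rcases subsingleton_or_nontrivial G with hG | hG
  · have hR : ∀ y, y ∈ S.RSSS x := fun y =>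
      ⟨Subsingleton.elim x y ▸ mem_conjugatesOf_self, ⟨1, le_rfl, Subsingleton.elim _ _⟩,
        ⟨1, le_rfl, Subsingleton.elim _ _⟩⟩
    have hC : ∀ y, y ∈ S.SC x := fun y => ⟨(hR y).1, 1, le_rfl, Subsingleton.elim _ _⟩
    have hU : ∀ y, y ∈ S.USS x := fun y =>
      ⟨⟨(hR y).1, fun z _ => (congrArg S.len (Subsingleton.elim y z)).le⟩, (hR y).2.1⟩
    have hSS : ∀ y, y ∈ S.SS x := fun y =>
      ⟨(hR y).1, fun z _ => (congrArg S.inf (Subsingleton.elim z y)).le⟩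
    exact ⟨⟨fun y _ => hR y, fun y _ => hU y, hUSS, fun y _ => hSS y⟩,
      fun _ => Set.ext fun y => iff_of_true (hC y) (hR y),
      fun _ => ⟨fun y _ => hR y, Set.ext fun y => iff_of_true (hR y) (hU y),
        Set.ext fun y => iff_of_true (hU y) (hUSS (hU y))⟩⟩
  have hΔ := S.Δ_ne_one
  have hRU : S.RSSS x ⊆ S.USS x := fun y hy => ⟨RSSS_subset_SSS hΔ hS x hy, hy.2.1⟩
  have hCR : S.SC x ⊆ S.RSSS x := by
    rcases Nat.lt_or_ge 1 (S.summitLen x) with h | h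
    · exact (SC_eq_RSSS_of_one_lt_summitLen hΔ hS h).subset
    · exact (SC_subset_SSS hΔ hS x).trans (SSS_subset_RSSS_of_summitLen_le_one hΔ hS h)
  refine ⟨⟨hCR, hRU, hUSS, SSS_subset_SS hΔ hS x⟩, SC_eq_RSSS_of_one_lt_summitLen hΔ hS,
    fun h => ⟨hCR, ?_, ?_⟩⟩
  · exact hRU.antisymm (hUSS.trans (SSS_subset_RSSS_of_summitLen_le_one hΔ hS h.le))
  · exact hUSS.antisymm ((SSS_subset_RSSS_of_summitLen_le_one hΔ hS h.le).trans hRU)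

end GarsideStructure

/-! ### Positive words on four strands -/

namespace PositiveBraid

/-- The complement `σᵢ \ σⱼ`: the word `w` such that `σᵢ w` is the least common multiple of `σᵢ`
and `σⱼ` in the monoid of positive braids on four strands. -/
def complement (i j : Fin 3) : List (Fin 3) :=
  if i = j then [] else if (i : ℕ) + 1 = j ∨ (j : ℕ) + 1 = i then [j, i] else [j]

/-- Equivalence of positive words, generated by reading off first letters: `i X` and `j Y` are
equivalent if `X` and `Y` are equivalent to words beginning with the two complements of `i` and `j`
and having the same remainder. -/
inductive WordEquiv : List (Fin 3) → List (Fin 3) → Prop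
  | nil : WordEquiv [] []
  | cons (i j : Fin 3) (X Y Z : List (Fin 3)) : WordEquiv X (complement i j ++ Z) →
      WordEquiv Y (complement j i ++ Z) → WordEquiv (i :: X) (j :: Y)

namespace WordEquiv

theorem refl (X : List (Fin 3)) : WordEquiv X X := by
  induction X with
  | nil => exact nil
  | cons i X ih => exact cons i i X X X (by simpa [complement]) (by simpa [complement])

theorem symm {X Y : List (Fin 3)} (h : WordEquiv X Y) : WordEquiv Y X := by
  cases h with
  | nil => exact nil
  | cons i j X Y Z h₁ h₂ => exact cons j i Y X Z h₂ h₁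

theorem length_complement (i j : Fin 3) : (complement i j).length = (complement j i).length := by
  revert i j; decide

theorem length_eq {X Y : List (Fin 3)} (h : WordEquiv X Y) : X.length = Y.length := by
  induction h with
  | nil => rfl
  | cons i j X Y Z _ _ ih₁ ih₂ =>
    simp only [List.length_append, List.length_cons] at *
    rw [ih₁, ih₂, length_complement]

theorem cons_right {X Y : List (Fin 3)} (i : Fin 3) (h : WordEquiv X Y) :
    WordEquiv (i :: X) (i :: Y) :=
  cons i i X Y Y (by simpa [complement]) (by simpa [complement] using refl Y)

theorem append_left (W : List (Fin 3)) {X Y : List (Fin 3)} (h : WordEquiv X Y) :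
    WordEquiv (W ++ X) (W ++ Y) := by
  induction W with
  | nil => exact h
  | cons i W ih => exact cons_right i ih

theorem append_right {X Y : List (Fin 3)} (h : WordEquiv X Y) (W : List (Fin 3)) :
    WordEquiv (X ++ W) (Y ++ W) := by
  induction h with
  | nil => exact refl W
  | cons i j X Y Z _ _ ih₁ ih₂ =>
    exact cons i j _ _ (Z ++ W) (by simpa using ih₁) (by simpa using ih₂)

theorem cons_inv {i j : Fin 3} {X Y : List (Fin 3)} (h : WordEquiv (i :: X) (j :: Y)) :
    ∃ Z, WordEquiv X (complement i j ++ Z) ∧ WordEquiv Y (complement j i ++ Z) := by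
  cases h with
  | cons i j X Y Z h₁ h₂ => exact ⟨Z, h₁, h₂⟩

/-- The defining relations of the braid monoid, applied at the beginning of a word. -/
theorem rel (i j : Fin 3) (Z : List (Fin 3)) :
    WordEquiv (i :: (complement i j ++ Z)) (j :: (complement j i ++ Z)) :=
  cons i j _ _ Z (refl _) (refl _)

/-- The cube condition: for pairwise different letters `i`, `j`, `k` with `i < k`, equivalences
`i X ~ j Y ~ k Z` combine, provided transitivity holds in smaller length. This is a computation with
the common multiples of the three letters. -/
theorem cube {n : ℕ} (ih : ∀ X Y Z : List (Fin 3), X.length < n → WordEquiv X Y → WordEquiv Y Z →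
    WordEquiv X Z) {i j k : Fin 3} (hij : i ≠ j) (hjk : j ≠ k) (hik : i < k)
    {X Y Z A B : List (Fin 3)} (hn : X.length < n) (hX : WordEquiv X (complement i j ++ A))
    (hYA : WordEquiv Y (complement j i ++ A)) (hYB : WordEquiv Y (complement j k ++ B))
    (hZ : WordEquiv Z (complement k j ++ B)) : WordEquiv (i :: X) (k :: Z) := by
  have tX : ∀ V W, WordEquiv X V → WordEquiv V W → WordEquiv X W := fun V W => ih X V W hn
  have hXY : X.length = Y.length := by
    rw [hX.length_eq, hYA.length_eq, List.length_append, List.length_append, length_complement]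
  have hYZ : Y.length = Z.length := by
    rw [hYB.length_eq, hZ.length_eq, List.length_append, List.length_append, length_complement]
  have tZ : ∀ V W, WordEquiv Z V → WordEquiv V W → WordEquiv Z W :=
    fun V W => ih Z V W (by omega)
  have hAB := ih _ _ _ (by rw [← hYA.length_eq]; omega) hYA.symm hYB
  have hcases : ∀ i j k : Fin 3, i ≠ j → j ≠ k → i < k →
      (i = 0 ∧ j = 1 ∧ k = 2) ∨ (i = 0 ∧ j = 2 ∧ k = 1) ∨ (i = 1 ∧ j = 0 ∧ k = 2) := by
    decide
  -- in each case, cancelling letters expresses `X` and `Z` as words with a common tail, and braid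
  -- moves then bring the complements of `i` and `k` to the front
  rcases hcases i j k hij hjk hik with ⟨rfl, rfl, rfl⟩ | ⟨rfl, rfl, rfl⟩ | ⟨rfl, rfl, rfl⟩
  · change WordEquiv X (1 :: 0 :: A) at hX
    change WordEquiv Z (1 :: 2 :: B) at hZ
    change WordEquiv (0 :: 1 :: A) (2 :: 1 :: B) at hAB
    obtain ⟨C, hA, hB⟩ := hAB.cons_inv
    obtain ⟨D, hA, hC⟩ : ∃ D, WordEquiv A (2 :: 1 :: D) ∧ WordEquiv C (1 :: 2 :: D) := hA.cons_inv
    obtain ⟨E, hB, hC'⟩ : ∃ E, WordEquiv B (0 :: 1 :: E) ∧ WordEquiv C (1 :: 0 :: E) := hB.cons_inv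
    have l₁ := hX.length_eq
    have l₂ := hA.length_eq
    have l₃ := hC.length_eq
    have l₄ := hC'.length_eq
    simp only [List.length_cons] at l₁ l₂ l₃ l₄
    -- cancel the common first letter of `1 2 D` and `1 0 E`
    obtain ⟨V, hD, hE⟩ := (ih _ _ _ (by simp only [List.length_cons]; omega) hC.symm hC').cons_inv
    obtain ⟨F, hD, hE⟩ : ∃ F, WordEquiv D (0 :: F) ∧ WordEquiv E (2 :: F) :=
      (ih _ V _ (by simp only [List.length_cons]; omega) hD hE.symm).cons_inv
    have hX' : WordEquiv X (1 :: 0 :: 2 :: 1 :: 0 :: F) := tX _ _ (tX _ _ hX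
      (append_left [1, 0] hA)) (append_left [1, 0, 2, 1] hD)
    have hZ' : WordEquiv Z (1 :: 2 :: 0 :: 1 :: 2 :: F) := tZ _ _ (tZ _ _ hZ
      (append_left [1, 2] hB)) (append_left [1, 2, 0, 1] hE)
    have hX : WordEquiv X (2 :: 1 :: 2 :: 0 :: 1 :: F) :=
      tX _ _ (tX _ _ (tX _ _ hX'
        (append_left [1] (rel 0 2 (1 :: 0 :: F))))
        (append_left [1, 2] (rel 0 1 F)))
        (rel 1 2 (0 :: 1 :: F))
    have hZ : WordEquiv Z (0 :: 1 :: 2 :: 0 :: 1 :: F) :=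
      tZ _ _ (tZ _ _ (tZ _ _ (tZ _ _ hZ'
        (append_left [1] (rel 2 0 (1 :: 2 :: F))))
        (append_left [1, 0] (rel 2 1 F)))
        (rel 1 0 (2 :: 1 :: F)))
        (append_left [0, 1] (rel 0 2 (1 :: F)))
    exact cons 0 2 X Z (1 :: 2 :: 0 :: 1 :: F) hX hZ
  · change WordEquiv X (2 :: A) at hX
    change WordEquiv Z (2 :: 1 :: B) at hZ
    change WordEquiv (0 :: A) (1 :: 2 :: B) at hAB
    obtain ⟨C, hA, hB⟩ : ∃ C, WordEquiv A (1 :: 0 :: C) ∧ WordEquiv (2 :: B) (0 :: 1 :: C) :=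
      hAB.cons_inv
    obtain ⟨D, hB, hC⟩ : ∃ D, WordEquiv B (0 :: D) ∧ WordEquiv (1 :: C) (2 :: D) := hB.cons_inv
    obtain ⟨E, hC, hD⟩ : ∃ E, WordEquiv C (2 :: 1 :: E) ∧ WordEquiv D (1 :: 2 :: E) := hC.cons_inv
    have hX' : WordEquiv X (2 :: 1 :: 0 :: 2 :: 1 :: E) := tX _ _ (tX _ _ hX
      (append_left [2] hA)) (append_left [2, 1, 0] hC)
    have hZ' : WordEquiv Z (2 :: 1 :: 0 :: 1 :: 2 :: E) := tZ _ _ (tZ _ _ hZ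
      (append_left [2, 1] hB)) (append_left [2, 1, 0] hD)
    have hX : WordEquiv X (1 :: 0 :: 2 :: 1 :: 0 :: E) :=
      tX _ _ (tX _ _ (tX _ _ (tX _ _ hX'
        (append_left [2, 1] (rel 0 2 (1 :: E))))
        (rel 2 1 (0 :: 1 :: E)))
        (append_left [1, 2] (rel 1 0 E)))
        (append_left [1] (rel 2 0 (1 :: 0 :: E)))
    have hZ : WordEquiv Z (0 :: 1 :: 2 :: 1 :: 0 :: E) :=
      tZ _ _ (tZ _ _ (tZ _ _ (tZ _ _ hZ'
        (append_left [2] (rel 1 0 (2 :: E))))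
        (rel 2 0 (1 :: 0 :: 2 :: E)))
        (append_left [0, 2, 1] (rel 0 2 E)))
        (append_left [0] (rel 2 1 (0 :: E)))
    exact cons 0 1 X Z (2 :: 1 :: 0 :: E) hX hZ
  · change WordEquiv X (0 :: 1 :: A) at hX
    change WordEquiv Z (0 :: B) at hZ
    change WordEquiv (1 :: 0 :: A) (2 :: B) at hAB
    obtain ⟨C, hA, hB⟩ : ∃ C, WordEquiv (0 :: A) (2 :: 1 :: C) ∧ WordEquiv B (1 :: 2 :: C) :=
      hAB.cons_inv
    obtain ⟨D, hA, hC⟩ : ∃ D, WordEquiv A (2 :: D) ∧ WordEquiv (1 :: C) (0 :: D) :=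
      let ⟨D, h₁, h₂⟩ := hA.cons_inv; ⟨D, h₁, h₂⟩
    obtain ⟨E, hC, hD⟩ : ∃ E, WordEquiv C (0 :: 1 :: E) ∧ WordEquiv D (1 :: 0 :: E) := hC.cons_inv
    have hX' : WordEquiv X (0 :: 1 :: 2 :: 1 :: 0 :: E) := tX _ _ (tX _ _ hX
      (append_left [0, 1] hA)) (append_left [0, 1, 2] hD)
    have hZ' : WordEquiv Z (0 :: 1 :: 2 :: 0 :: 1 :: E) := tZ _ _ (tZ _ _ hZ
      (append_left [0] hB)) (append_left [0, 1, 2] hC)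
    have hX : WordEquiv X (2 :: 1 :: 0 :: 1 :: 2 :: E) :=
      tX _ _ (tX _ _ (tX _ _ (tX _ _ hX'
        (append_left [0] (rel 1 2 (0 :: E))))
        (rel 0 2 (1 :: 2 :: 0 :: E)))
        (append_left [2, 0, 1] (rel 2 0 E)))
        (append_left [2] (rel 0 1 (2 :: E)))
    have hZ : WordEquiv Z (1 :: 2 :: 0 :: 1 :: 2 :: E) :=
      tZ _ _ (tZ _ _ (tZ _ _ (tZ _ _ hZ'
        (append_left [0, 1] (rel 2 0 (1 :: E))))
        (rel 0 1 (2 :: 1 :: E)))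
        (append_left [1, 0] (rel 1 2 E)))
        (append_left [1] (rel 0 2 (1 :: 2 :: E)))
    exact cons 1 2 X Z (0 :: 1 :: 2 :: E) hX hZ

/-- Transitivity, by induction on the length of the words: the first letters are compared, and the
remainders are shorter. -/
theorem trans_aux (n : ℕ) : ∀ X Y Z : List (Fin 3), X.length < n → WordEquiv X Y → WordEquiv Y Z →
    WordEquiv X Z := by
  induction n with
  | zero => intro X Y Z h; omega
  | succ n ih =>
    intro X Y Z hlen h₁ h₂
    have hXY := h₁.length_eq
    have hYZ := h₂.length_eq
    match X, Y, Z, h₁, h₂ with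
    | [], [], [], h₁, _ => exact h₁
    | i :: X, j :: Y, k :: Z, h₁, h₂ =>
      simp only [List.length_cons, add_lt_add_iff_right, add_left_inj] at hlen hXY hYZ
      obtain ⟨A, hX, hYA⟩ := h₁.cons_inv
      obtain ⟨B, hYB, hZ⟩ := h₂.cons_inv
      by_cases hij : i = j
      · subst hij
        simp only [complement, if_true, List.nil_append] at hX hYA
        exact cons i k X Z B (ih _ _ _ hlen hX (ih _ _ _ (by rw [← hX.length_eq]; exact hlen)
          hYA.symm hYB)) hZ
      by_cases hjk : j = k
      · subst hjk
        simp only [complement, if_true, List.nil_append] at hYB hZ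
        exact cons i j X Z A hX (ih _ _ _ (by omega) hZ (ih _ _ _ (by
          rw [← hYB.length_eq]; omega) hYB.symm hYA))
      rcases lt_trichotomy i k with hik | hik | hik
      · exact cube ih hij hjk hik hlen hX hYA hYB hZ
      · subst hik
        have hAB := ih _ _ _ (by rw [← hYA.length_eq]; omega) hYA.symm hYB
        have hcancel : ∀ (W A B : List (Fin 3)), (W ++ A).length < n → WordEquiv (W ++ A) (W ++ B) →
            WordEquiv A B := by
          intro W
          induction W with
          | nil => exact fun _ _ _ h => h
          | cons w W ihW =>
            intro A B hl h
            obtain ⟨C, hA, hB⟩ := cons_inv h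
            simp only [complement, if_true, List.nil_append] at hA hB
            simp only [List.cons_append, List.length_cons] at hl
            exact ihW A B (by omega) (ih _ _ _ (by omega) hA hB.symm)
        have hAB' := hcancel _ _ _ (by rw [← hYA.length_eq]; omega) hAB
        exact cons_right i (ih _ _ _ hlen hX (ih _ _ _ (by rw [← hX.length_eq]; exact hlen)
          (hAB'.append_left _) hZ.symm))
      · exact (cube ih (Ne.symm hjk) (Ne.symm hij) hik (by omega) hZ hYB hYA hX).symm

theorem trans {X Y Z : List (Fin 3)} (h₁ : WordEquiv X Y) (h₂ : WordEquiv Y Z) : WordEquiv X Z :=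
  trans_aux (X.length + 1) X Y Z (by omega) h₁ h₂

end WordEquiv
end PositiveBraid

namespace PositiveBraid

/-! ### The Garside word -/

open WordEquiv

/-- Applying a braid relation inside a word. -/
theorem WordEquiv.step (W : List (Fin 3)) (i j : Fin 3) (Z : List (Fin 3)) :
    WordEquiv (W ++ i :: (complement i j ++ Z)) (W ++ j :: (complement j i ++ Z)) :=
  append_left W (rel i j Z)

theorem WordEquiv.cancel_left {W X Y : List (Fin 3)} (h : WordEquiv (W ++ X) (W ++ Y)) :
    WordEquiv X Y := by
  induction W with
  | nil => exact h
  | cons w W ih =>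
    obtain ⟨Z, h₁, h₂⟩ := cons_inv h
    simp only [complement, if_true, List.nil_append] at h₁ h₂
    exact ih (h₁.trans h₂.symm)

/-- The word `σ₁ (σ₂ σ₁) (σ₃ σ₂ σ₁)` of the Garside element, with letters numbered from `0`. -/
def garsideWord : List (Fin 3) := [0, 1, 0, 2, 1, 0]

theorem cons_garsideWord (i : Fin 3) :
    WordEquiv (i :: garsideWord) (garsideWord ++ [Fin.rev i]) := by
  fin_cases i
  · exact ((step [0] 0 1 [2, 1, 0]).trans (step [0, 1, 0] 1 2 [0])).trans
      (step [0, 1, 0, 2, 1] 2 0 [])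
  · exact ((step [] 1 0 [0, 2, 1, 0]).trans (step [0, 1, 0] 0 2 [1, 0])).trans
      (step [0, 1, 0, 2] 0 1 [])
  · exact ((((step [] 2 0 [1, 0, 2, 1, 0]).trans (step [0, 2, 1] 0 2 [1, 0])).trans
      (step [0] 2 1 [0, 1, 0])).trans (step [0, 1, 2] 1 0 [0])).trans (step [0, 1] 2 0 [1, 0, 0])

theorem exists_garsideWord_equiv_cons (i : Fin 3) : ∃ X, WordEquiv garsideWord (i :: X) := by
  fin_cases i
  · exact ⟨_, refl _⟩
  · exact ⟨_, step [] 0 1 [2, 1, 0]⟩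
  · exact ⟨[0, 1, 2, 0, 1], (((step [0, 1] 0 2 [1, 0]).trans (step [0, 1, 2] 0 1 [])).trans
      (step [0] 1 2 [0, 1])).trans (step [] 0 2 [1, 2, 0, 1])⟩

/-! ### The monoid of positive braids -/

/-- The congruence on the free monoid given by equivalence of positive words. -/
def wordCon : Con (FreeMonoid (Fin 3)) where
  r X Y := WordEquiv X.toList Y.toList
  iseqv := ⟨fun _ => refl _, WordEquiv.symm, WordEquiv.trans⟩
  mul' h₁ h₂ := by
    simp only [FreeMonoid.toList_mul]
    exact (append_right h₁ _).trans (append_left _ h₂)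

/-- The class of a word in the monoid of positive braids on four strands. -/
def word (X : List (Fin 3)) : wordCon.Quotient := (FreeMonoid.ofList X : wordCon.Quotient)

theorem word_append (X Y : List (Fin 3)) : word (X ++ Y) = word X * word Y := rfl

theorem word_nil : word [] = 1 := rfl

theorem word_eq_iff {X Y : List (Fin 3)} : word X = word Y ↔ WordEquiv X Y := wordCon.eq

theorem exists_eq_word (a : wordCon.Quotient) : ∃ X, a = word X := by
  induction a using Con.induction_on with
  | H x => exact ⟨x.toList, rfl⟩

/-- The class of `Δ²`, which is central. -/
def fullTwist : wordCon.Quotient := word (garsideWord ++ garsideWord)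

theorem fullTwist_mul (a : wordCon.Quotient) : fullTwist * a = a * fullTwist := by
  obtain ⟨X, rfl⟩ := exists_eq_word a
  rw [fullTwist, ← word_append, ← word_append, word_eq_iff]
  induction X with
  | nil => simpa using refl _
  | cons i X ih =>
    have h₁ : WordEquiv ([i] ++ garsideWord ++ garsideWord)
        (garsideWord ++ garsideWord ++ [i]) := by
      have h := append_left garsideWord (cons_garsideWord (Fin.rev i))
      rw [Fin.rev_rev] at h
      exact (append_right (cons_garsideWord i) garsideWord).trans (by simpa using h)
    have h₂ := (append_right h₁ X).symm.trans (by simpa using append_left [i] ih)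
    simpa using h₂

theorem fullTwist_pow_mul_cancel (n : ℕ) {a b : wordCon.Quotient}
    (h : fullTwist ^ n * a = fullTwist ^ n * b) : a = b := by
  obtain ⟨X, rfl⟩ := exists_eq_word a
  obtain ⟨Y, rfl⟩ := exists_eq_word b
  obtain ⟨W, hW⟩ := exists_eq_word (fullTwist ^ n)
  rw [hW, ← word_append, ← word_append, word_eq_iff] at h
  exact word_eq_iff.2 h.cancel_left

/-- Since `Δ²` is central, its powers form an Ore set, with numerators and denominators left
unchanged. -/
instance : OreLocalization.OreSet (Submonoid.powers fullTwist) where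
  ore_right_cancel r₁ r₂ s h := by
    obtain ⟨_, n, rfl⟩ := s
    have hc : ∀ r, r * fullTwist ^ n = fullTwist ^ n * r := fun r =>
      (((show Commute fullTwist r from fullTwist_mul r).pow_left n).eq).symm
    exact ⟨⟨_, n, rfl⟩, by simpa only [hc] using h⟩
  oreNum r _ := r
  oreDenom _ s := s
  ore_eq r s := by
    obtain ⟨_, n, rfl⟩ := s
    exact (show Commute fullTwist r from fullTwist_mul r).pow_left n

/-- The monoid of positive braids with `Δ²` inverted. -/
abbrev Fractions : Type := OreLocalization (Submonoid.powers fullTwist) wordCon.Quotient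

/-- The canonical map from the positive monoid to its fractions. -/
noncomputable def toFractions : wordCon.Quotient →* Fractions := OreLocalization.numeratorHom

theorem toFractions_injective : Function.Injective toFractions := by
  intro a b h
  obtain ⟨⟨_, n, rfl⟩, v, h₁, h₂⟩ := OreLocalization.oreDiv_eq_iff.1 h
  simp only [OneMemClass.coe_one, mul_one] at h₂
  subst h₂
  exact (fullTwist_pow_mul_cancel n h₁).symm

theorem isUnit_toFractions_word (i : Fin 3) : IsUnit (toFractions (word [i])) := by
  obtain ⟨X, hX⟩ := exists_garsideWord_equiv_cons i
  set a := word [i]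
  set b := word (X ++ garsideWord)
  have hab : fullTwist = a * b := word_eq_iff.2 (append_right hX garsideWord)
  -- `Δ²` is central and `a` can be cancelled, so that `a b = Δ²` gives `b a = Δ²`
  have hba : fullTwist = b * a := by
    have h : a * fullTwist = a * (b * a) := by rw [← fullTwist_mul, ← mul_assoc, ← hab]
    obtain ⟨Y, hY⟩ := exists_eq_word fullTwist
    obtain ⟨Z, hZ⟩ := exists_eq_word (b * a)
    rw [hY, hZ] at h ⊢
    exact word_eq_iff.2 (WordEquiv.cancel_left (W := [i]) (word_eq_iff.1 h))
  have hu : IsUnit (toFractions fullTwist) :=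
    OreLocalization.numerator_isUnit (⟨fullTwist, 1, pow_one _⟩ : Submonoid.powers fullTwist)
  have hc : Commute (toFractions a) (toFractions b) := by
    change _ * _ = _ * _
    rw [← map_mul, ← map_mul, ← hab, ← hba]
  refine (hc.isUnit_mul_iff.1 ?_).1
  rwa [← map_mul, ← hab]

/-! ### Embedding positive words into the braid group -/

/-- The braid represented by a positive word. -/
def braid (X : List (Fin 3)) : BraidGroup 4 := (X.map (braidGen 4)).prod

theorem braid_append (X Y : List (Fin 3)) : braid (X ++ Y) = braid X * braid Y := by
  simp [braid]

theorem braid_cons (i : Fin 3) (X : List (Fin 3)) : braid (i :: X) = braidGen 4 i * braid X := by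
  simp [braid]

theorem braidGen_comm {i j : Fin 3} (h : (i : ℕ) + 2 ≤ j) :
    braidGen 4 i * braidGen 4 j = braidGen 4 j * braidGen 4 i := by
  have := PresentedGroup.one_of_mem (rels := braidRels 4) (Or.inl ⟨i, j, h, rfl⟩)
  simp only [map_mul, map_inv] at this
  exact mul_inv_eq_one.1 this

theorem braidGen_braid {i j : Fin 3} (h : (i : ℕ) + 1 = j) :
    braidGen 4 i * braidGen 4 j * braidGen 4 i = braidGen 4 j * braidGen 4 i * braidGen 4 j := by
  have := PresentedGroup.one_of_mem (rels := braidRels 4) (Or.inr ⟨i, j, h, rfl⟩)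
  simp only [map_mul, map_inv] at this
  exact mul_inv_eq_one.1 this

theorem braid_cons_complement (i j : Fin 3) :
    braid (i :: complement i j) = braid (j :: complement j i) := by
  by_cases hij : i = j
  · rw [hij]
  have hji := Ne.symm hij
  simp only [complement, hij, hji, if_false, or_comm (a := (j : ℕ) + 1 = i)]
  split_ifs with h
  · rcases h with h | h
    · simpa [braid, mul_assoc] using braidGen_braid h
    · simpa [braid, mul_assoc] using (braidGen_braid h).symm
  · have : (i : ℕ) ≠ j := fun h => hij (Fin.ext h)
    rcases (show (i : ℕ) + 2 ≤ j ∨ (j : ℕ) + 2 ≤ i by omega) with h | h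
    · simpa [braid] using braidGen_comm h
    · simpa [braid] using (braidGen_comm h).symm

theorem WordEquiv.braid_eq {X Y : List (Fin 3)} (h : WordEquiv X Y) : braid X = braid Y := by
  induction h with
  | nil => rfl
  | cons i j X Y Z _ _ ih₁ ih₂ =>
    rw [braid_cons, braid_cons, ih₁, ih₂, ← braid_cons, ← braid_cons, ← List.cons_append,
      ← List.cons_append, braid_append, braid_append, braid_cons_complement]

/-- The images of the generators in the group of units of the monoid of fractions. -/
noncomputable def genUnit (i : Fin 3) : Fractionsˣ := (isUnit_toFractions_word i).unit

theorem lift_genUnit_eq_one : ∀ r ∈ braidRels 4, FreeGroup.lift genUnit r = 1 := by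
  have key : ∀ (i j : Fin 3), ((i :: complement i j).map genUnit).prod =
      ((j :: complement j i).map genUnit).prod := by
    have hval : ∀ X : List (Fin 3), ((X.map genUnit).prod : Fractions) = toFractions (word X) := by
      intro X
      induction X with
      | nil => simp [word_nil]
      | cons i X ih =>
        rw [List.map_cons, List.prod_cons, Units.val_mul, ih, ← List.singleton_append, word_append,
          map_mul]
        rfl
    intro i j
    refine Units.ext ?_
    rw [hval, hval]
    congr 1
    exact word_eq_iff.2 (by simpa using rel i j [])
  rintro r (⟨i, j, h, rfl⟩ | ⟨i, j, h, rfl⟩)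
  · have hk := key i j
    have h₁ : i ≠ j := by rintro rfl; omega
    have h₂ : ¬ ((i : ℕ) + 1 = j ∨ (j : ℕ) + 1 = i) := by omega
    simp only [complement, h₁, h₁.symm, h₂, or_comm.not.1 h₂, if_false] at hk
    rw [map_mul, map_inv, mul_inv_eq_one]
    simpa using hk
  · have hk := key i j
    have h₁ : i ≠ j := by rintro rfl; omega
    simp only [complement, h₁, h₁.symm, h, true_or, or_true, if_false, if_true] at hk
    rw [map_mul, map_inv, mul_inv_eq_one]
    simpa [mul_assoc] using hk

/-- The positive monoid embeds into the braid group. -/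
theorem wordEquiv_of_braid_eq {X Y : List (Fin 3)} (h : braid X = braid Y) : WordEquiv X Y := by
  have hval : ∀ X : List (Fin 3),
      (PresentedGroup.toGroup lift_genUnit_eq_one (braid X) : Fractions) =
        toFractions (word X) := by
    intro X
    induction X with
    | nil => simp [word_nil, braid]
    | cons i X ih =>
      rw [braid_cons, map_mul, Units.val_mul, ih, ← List.singleton_append, word_append, map_mul]
      congr 1
      exact congrArg Units.val (PresentedGroup.toGroup.of lift_genUnit_eq_one)
  rw [← word_eq_iff]
  refine toFractions_injective ?_
  rw [← hval, ← hval, h]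

theorem braid_eq_iff {X Y : List (Fin 3)} : braid X = braid Y ↔ WordEquiv X Y :=
  ⟨wordEquiv_of_braid_eq, WordEquiv.braid_eq⟩

end PositiveBraid

namespace PositiveBraid

open WordEquiv

/-! ### The prefix order on the braid group is a lattice -/

/-- The submonoid of positive braids on four strands. -/
def positive : Submonoid (BraidGroup 4) := Submonoid.closure (Set.range (braidGen 4))

theorem braid_mem (X : List (Fin 3)) : braid X ∈ positive :=
  positive.list_prod_mem fun a ha => by
    obtain ⟨i, -, rfl⟩ := List.mem_map.1 ha
    exact Submonoid.subset_closure ⟨i, rfl⟩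

theorem mem_positive_iff {a : BraidGroup 4} : a ∈ positive ↔ ∃ X, a = braid X := by
  refine ⟨fun h => ?_, by rintro ⟨X, rfl⟩; exact braid_mem X⟩
  induction h using Submonoid.closure_induction with
  | mem a ha =>
    obtain ⟨i, rfl⟩ := ha
    exact ⟨[i], by simp [braid]⟩
  | one => exact ⟨[], by simp [braid]⟩
  | mul a b _ _ ha hb =>
    obtain ⟨X, rfl⟩ := ha
    obtain ⟨Y, rfl⟩ := hb
    exact ⟨X ++ Y, (braid_append X Y).symm⟩

theorem braidGen_mem (i : Fin 3) : braidGen 4 i ∈ positive :=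
  Submonoid.subset_closure ⟨i, rfl⟩

/-- The homomorphism `B₄ → ℤ` sending every standard generator to `1`. -/
def exponentHom : BraidGroup 4 →* Multiplicative ℤ :=
  PresentedGroup.toGroup (f := fun _ => Multiplicative.ofAdd 1) (by
    rintro r (⟨i, j, -, rfl⟩ | ⟨i, j, -, rfl⟩) <;> simp)

/-- The exponent sum of a braid. -/
def exponentSum (a : BraidGroup 4) : ℤ := (exponentHom a).toAdd

theorem exponentSum_mul (a b : BraidGroup 4) :
    exponentSum (a * b) = exponentSum a + exponentSum b := by
  simp [exponentSum]

theorem exponentSum_braid (X : List (Fin 3)) : exponentSum (braid X) = X.length := by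
  induction X with
  | nil => simp [exponentSum, braid]
  | cons i X ih =>
    have : exponentSum (braidGen 4 i) = 1 :=
      congrArg Multiplicative.toAdd (PresentedGroup.toGroup.of _)
    rw [braid_cons, exponentSum_mul, ih, this, List.length_cons, Nat.cast_succ, add_comm]

theorem exponentSum_nonneg {a : BraidGroup 4} (ha : a ∈ positive) : 0 ≤ exponentSum a := by
  obtain ⟨X, rfl⟩ := mem_positive_iff.1 ha
  rw [exponentSum_braid]
  positivity

theorem eq_one_of_exponentSum_eq_zero {a : BraidGroup 4} (ha : a ∈ positive)
    (h : exponentSum a = 0) : a = 1 := by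
  obtain ⟨X, rfl⟩ := mem_positive_iff.1 ha
  rw [exponentSum_braid, Nat.cast_eq_zero, List.length_eq_zero_iff] at h
  simp [h, braid]

theorem exponentSum_le {a b : BraidGroup 4} (h : PrefixLE positive a b) :
    exponentSum a ≤ exponentSum b := by
  have h₁ := exponentSum_nonneg h
  have h₂ := exponentSum_mul a (a⁻¹ * b)
  rw [mul_inv_cancel_left] at h₂
  omega

theorem eq_of_prefixLE {a b : BraidGroup 4} (h : PrefixLE positive a b)
    (hle : exponentSum b ≤ exponentSum a) : a = b := by
  have h₁ := exponentSum_nonneg h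
  have h₂ := exponentSum_mul a (a⁻¹ * b)
  rw [mul_inv_cancel_left] at h₂
  exact inv_mul_eq_one.1 (eq_one_of_exponentSum_eq_zero h (by omega))

/-- The local lcm property: a common multiple of two generators is a multiple of their least common
multiple. -/
theorem braid_complement_prefixLE {i j : Fin 3} {x y : BraidGroup 4} (hx : x ∈ positive)
    (hy : y ∈ positive) (h : braidGen 4 i * x = braidGen 4 j * y) :
    PrefixLE positive (braid (complement i j)) x ∧
      PrefixLE positive (braid (complement j i)) y := by
  obtain ⟨X, rfl⟩ := mem_positive_iff.1 hx
  obtain ⟨Y, rfl⟩ := mem_positive_iff.1 hy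
  rw [← braid_cons, ← braid_cons, braid_eq_iff] at h
  obtain ⟨Z, h₁, h₂⟩ := h.cons_inv
  rw [h₁.braid_eq, h₂.braid_eq, braid_append, braid_append]
  simp [PrefixLE, braid_mem]

theorem mem_of_prefixLE {a b : BraidGroup 4} (ha : a ∈ positive) (h : PrefixLE positive a b) :
    b ∈ positive := by
  simpa using positive.mul_mem ha h

/-- Two positive divisors of a positive braid have a least common multiple. By induction on the
length of the multiple: after the two first letters `i`, `j` are enlarged to their least common
multiple, each of the divisors is joined with it after cancelling its own first letter, and the two
results are joined after cancelling `i`. -/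
theorem exists_lcm_of_common_multiple (n : ℕ) : ∀ a ∈ positive, exponentSum a < n →
    ∀ c ∈ positive, ∀ d ∈ positive, PrefixLE positive c a → PrefixLE positive d a →
      ∃ m, PrefixLE positive c m ∧ PrefixLE positive d m ∧
        ∀ e, PrefixLE positive c e → PrefixLE positive d e → PrefixLE positive m e := by
  induction n with
  | zero =>
    intro a ha h
    have := exponentSum_nonneg ha
    omega
  | succ n ih =>
    intro a ha hn c hc d hd hca hda
    obtain ⟨C, rfl⟩ := mem_positive_iff.1 hc
    obtain ⟨D, rfl⟩ := mem_positive_iff.1 hd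
    rcases C with _ | ⟨i, C⟩
    · exact ⟨braid D, by simpa [braid, PrefixLE] using hd, PrefixLE.refl _ _, fun e _ h => h⟩
    rcases D with _ | ⟨j, D⟩
    · exact ⟨braid (i :: C), PrefixLE.refl _ _, by simpa [braid, PrefixLE] using hc,
        fun e h _ => h⟩
    simp only [braid_cons] at hca hda ⊢
    -- cancelling a first letter
    have key : ∀ (i : Fin 3) (b e : BraidGroup 4), PrefixLE positive (braidGen 4 i * b) e ↔
        PrefixLE positive b ((braidGen 4 i)⁻¹ * e) := fun i b e => by
      rw [← prefixLE_mul_left_iff positive (braidGen 4 i) b, mul_inv_cancel_left]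
    have hsum : ∀ i : Fin 3, exponentSum ((braidGen 4 i)⁻¹ * a) < n := fun i => by
      have h₁ := exponentSum_mul (braidGen 4 i) ((braidGen 4 i)⁻¹ * a)
      have h₂ := exponentSum_braid [i]
      rw [braid_cons] at h₂
      simp only [braid, List.map_nil, List.prod_nil, mul_one, List.length_singleton] at h₂
      rw [mul_inv_cancel_left] at h₁
      push_cast at hn h₂
      omega
    have hlocal : ∀ e, PrefixLE positive (braidGen 4 i * braid C) e →
        PrefixLE positive (braidGen 4 j * braid D) e →
        PrefixLE positive (braid (complement i j)) ((braidGen 4 i)⁻¹ * e) ∧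
          PrefixLE positive (braid (complement j i)) ((braidGen 4 j)⁻¹ * e) := fun e h₁ h₂ =>
      braid_complement_prefixLE (mem_of_prefixLE (braid_mem C) ((key _ _ _).1 h₁))
        (mem_of_prefixLE (braid_mem D) ((key _ _ _).1 h₂)) (by simp)
    have hij : (braidGen 4 i)⁻¹ * (braidGen 4 j * braid (complement j i)) =
        braid (complement i j) := by
      rw [← braid_cons, ← braid_cons_complement, braid_cons, inv_mul_cancel_left]
    have hci := (key _ _ _).1 hca
    have hdj := (key _ _ _).1 hda
    have hai := mem_of_prefixLE (braid_mem C) hci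
    have haj := mem_of_prefixLE (braid_mem D) hdj
    obtain ⟨hui, huj⟩ := hlocal a hca hda
    obtain ⟨m₁, hm₁, hm₁', hmin₁⟩ := ih _ hai (hsum i) _ (braid_mem C) _ (braid_mem _) hci hui
    obtain ⟨m₂, hm₂, hm₂', hmin₂⟩ := ih _ haj (hsum j) _ (braid_mem D) _ (braid_mem _) hdj huj
    -- the second join as a multiple of the first letter `i`
    have hswap : ∀ e, PrefixLE positive m₂ ((braidGen 4 j)⁻¹ * e) →
        PrefixLE positive ((braidGen 4 i)⁻¹ * (braidGen 4 j * m₂)) ((braidGen 4 i)⁻¹ * e) :=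
      fun e h => by rwa [prefixLE_mul_left_iff, key]
    have hpos₂ : (braidGen 4 i)⁻¹ * (braidGen 4 j * m₂) ∈ positive := by
      refine mem_of_prefixLE (braid_mem (complement i j)) ?_
      rw [← hij, prefixLE_mul_left_iff, prefixLE_mul_left_iff]
      exact hm₂'
    obtain ⟨m₃, hm₃, hm₃', hmin₃⟩ := ih _ hai (hsum i) _ (mem_of_prefixLE (braid_mem C) hm₁) _ hpos₂
      (hmin₁ _ hci hui) (hswap a (hmin₂ _ hdj huj))
    refine ⟨braidGen 4 i * m₃, ?_, ?_, fun e h₁ h₂ => ?_⟩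
    · rw [prefixLE_mul_left_iff]
      exact hm₁.trans hm₃
    · refine PrefixLE.trans (b := braidGen 4 j * m₂) ?_ ?_
      · rwa [prefixLE_mul_left_iff]
      · rwa [← prefixLE_mul_left_iff positive (braidGen 4 i), mul_inv_cancel_left] at hm₃'
    · obtain ⟨hei, hej⟩ := hlocal e h₁ h₂
      rw [key] at h₁ h₂ ⊢
      exact hmin₃ _ (hmin₁ _ h₁ hei) (hswap e (hmin₂ _ h₂ hej))

/-- The Garside element of `B₄`. -/
def garsideElement : BraidGroup 4 := braid garsideWord

theorem braid_mul_garsideElement (X : List (Fin 3)) :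
    braid X * garsideElement = garsideElement * braid (X.map Fin.rev) := by
  induction X with
  | nil => simp [braid]
  | cons i X ih =>
    have h := (cons_garsideWord i).braid_eq
    rw [braid_cons, braid_append] at h
    rw [braid_cons, mul_assoc, ih, ← mul_assoc, garsideElement, h, List.map_cons, braid_cons]
    simp [braid, mul_assoc]

theorem garsideElement_sq_comm (a : BraidGroup 4) : Commute (garsideElement ^ 2) a := by
  have ha : a ∈ Subgroup.closure (Set.range (braidGen 4)) := by
    change a ∈ Subgroup.closure (Set.range (PresentedGroup.of (rels := braidRels 4)))
    rw [PresentedGroup.closure_range_of]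
    trivial
  induction ha using Subgroup.closure_induction with
  | mem a ha =>
    obtain ⟨i, rfl⟩ := ha
    have h := braid_mul_garsideElement [i]
    have h' := braid_mul_garsideElement [Fin.rev i]
    simp only [braid, List.map_cons, List.map_nil, List.prod_singleton, Fin.rev_rev] at h h'
    change _ * _ = _ * _
    rw [sq, mul_assoc, ← h', ← mul_assoc, ← h, mul_assoc]
  | one => exact Commute.one_right _
  | mul a b _ _ ha hb => exact ha.mul_right hb
  | inv a _ ha => exact ha.inv_right

/-- Every braid becomes positive after multiplication by a power of `Δ²`. -/
theorem exists_sq_pow_mul_mem (a : BraidGroup 4) :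
    ∃ n : ℕ, (garsideElement ^ 2) ^ n * a ∈ positive := by
  have hΔ : garsideElement ^ 2 ∈ positive := positive.pow_mem (braid_mem _) 2
  suffices h : (∃ n : ℕ, (garsideElement ^ 2) ^ n * a ∈ positive) ∧
      ∃ n : ℕ, (garsideElement ^ 2) ^ n * a⁻¹ ∈ positive from h.1
  have hmul : ∀ a b : BraidGroup 4, (∃ n : ℕ, (garsideElement ^ 2) ^ n * a ∈ positive) →
      (∃ n : ℕ, (garsideElement ^ 2) ^ n * b ∈ positive) →
      ∃ n : ℕ, (garsideElement ^ 2) ^ n * (a * b) ∈ positive := by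
    rintro a b ⟨n, hn⟩ ⟨m, hm⟩
    refine ⟨n + m, ?_⟩
    have h := positive.mul_mem hn hm
    rwa [mul_assoc, ← mul_assoc a, ← ((garsideElement_sq_comm a).pow_left m).eq, mul_assoc,
      ← mul_assoc, ← pow_add] at h
  have ha : a ∈ Subgroup.closure (Set.range (braidGen 4)) := by
    change a ∈ Subgroup.closure (Set.range (PresentedGroup.of (rels := braidRels 4)))
    rw [PresentedGroup.closure_range_of]
    trivial
  induction ha using Subgroup.closure_induction with
  | mem a ha =>
    obtain ⟨i, rfl⟩ := ha
    refine ⟨⟨0, by simpa using braidGen_mem i⟩, 1, ?_⟩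
    obtain ⟨X, hX⟩ := exists_garsideWord_equiv_cons i
    have h : garsideElement = braidGen 4 i * braid X := by
      rw [garsideElement, hX.braid_eq, braid_cons]
    rw [pow_one, (garsideElement_sq_comm _).eq, sq]
    nth_rewrite 1 [h]
    rw [mul_assoc, inv_mul_cancel_left]
    exact positive.mul_mem (braid_mem _) (braid_mem _)
  | one => exact ⟨⟨0, by simp⟩, 0, by simp⟩
  | mul a b _ _ ha hb =>
    exact ⟨hmul a b ha.1 hb.1, by simpa using hmul b⁻¹ a⁻¹ hb.2 ha.2⟩
  | inv a _ ha => exact ⟨ha.2, by simpa using ha.1⟩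

theorem exists_prefixLE_sq_pow (a b : BraidGroup 4) : ∃ n : ℕ,
    PrefixLE positive a ((garsideElement ^ 2) ^ n) ∧
      PrefixLE positive b ((garsideElement ^ 2) ^ n) := by
  obtain ⟨n, hn⟩ := exists_sq_pow_mul_mem a⁻¹
  obtain ⟨m, hm⟩ := exists_sq_pow_mul_mem b⁻¹
  have hΔ : garsideElement ^ 2 ∈ positive := positive.pow_mem (braid_mem _) 2
  refine ⟨n + m, ?_, ?_⟩
  · have h := positive.mul_mem (positive.pow_mem hΔ m) hn
    rwa [← mul_assoc, ← pow_add, add_comm, ((garsideElement_sq_comm _).pow_left _).eq] at h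
  · have h := positive.mul_mem (positive.pow_mem hΔ n) hm
    rwa [← mul_assoc, ← pow_add, ((garsideElement_sq_comm _).pow_left _).eq] at h

theorem exists_lcm (a b : BraidGroup 4) : ∃ m, PrefixLE positive a m ∧ PrefixLE positive b m ∧
    ∀ c, PrefixLE positive a c → PrefixLE positive b c → PrefixLE positive m c := by
  -- translate the two braids by a power of `Δ²`, so that they become positive
  obtain ⟨n, hn₁, hn₂⟩ := exists_prefixLE_sq_pow a⁻¹ b⁻¹
  set z := (garsideElement ^ 2) ^ n with hz
  have hpos : ∀ g, PrefixLE positive g⁻¹ z → z * g ∈ positive := fun g h => by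
    rw [((garsideElement_sq_comm g).pow_left n).eq]
    simpa [PrefixLE] using h
  obtain ⟨k, hk₁, hk₂⟩ := exists_prefixLE_sq_pow (z * a) (z * b)
  have hk : (garsideElement ^ 2) ^ k ∈ positive :=
    positive.pow_mem (positive.pow_mem (braid_mem _) 2) k
  obtain ⟨m, h₁, h₂, h₃⟩ := exists_lcm_of_common_multiple
    ((exponentSum ((garsideElement ^ 2) ^ k)).toNat + 1) _ hk (by push_cast; omega) _ (hpos a hn₁) _
    (hpos b hn₂) hk₁ hk₂
  refine ⟨z⁻¹ * m, ?_, ?_, fun c hac hbc => ?_⟩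
  · rwa [← prefixLE_mul_left_iff positive z, mul_inv_cancel_left]
  · rwa [← prefixLE_mul_left_iff positive z, mul_inv_cancel_left]
  · rw [← prefixLE_mul_left_iff positive z, mul_inv_cancel_left]
    exact h₃ _ ((prefixLE_mul_left_iff _ _ _ _).2 hac) ((prefixLE_mul_left_iff _ _ _ _).2 hbc)

/-- A common divisor of maximal exponent sum is the greatest one: its least common multiple with
any other common divisor is again a common divisor. -/
theorem exists_gcd (a b : BraidGroup 4) : ∃ d, PrefixLE positive d a ∧ PrefixLE positive d b ∧
    ∀ c, PrefixLE positive c a → PrefixLE positive c b → PrefixLE positive c d := by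
  obtain ⟨n, hn₁, hn₂⟩ := exists_prefixLE_sq_pow a⁻¹ b⁻¹
  have hlow : ∀ g, PrefixLE positive g⁻¹ ((garsideElement ^ 2) ^ n) →
      PrefixLE positive ((garsideElement ^ 2) ^ n)⁻¹ g := fun g h => by
    rw [PrefixLE, inv_inv, ((garsideElement_sq_comm g).pow_left n).eq]
    simpa [PrefixLE] using h
  obtain ⟨N, ⟨d, hda, hdb, hN⟩, hmax⟩ := Int.exists_greatest_of_bdd
    (P := fun N => ∃ d, PrefixLE positive d a ∧ PrefixLE positive d b ∧ exponentSum d = N)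
    ⟨exponentSum a, by rintro _ ⟨d, hd, -, rfl⟩; exact exponentSum_le hd⟩
    ⟨_, _, hlow a hn₁, hlow b hn₂, rfl⟩
  refine ⟨d, hda, hdb, fun c hca hcb => ?_⟩
  obtain ⟨m, hdm, hcm, hm⟩ := exists_lcm d c
  rw [eq_of_prefixLE hdm (hN ▸ hmax _ ⟨m, hm a hda hca, hm b hdb hcb, rfl⟩)]
  exact hcm

/-! ### The Artin Garside structure of the braid group on four strands -/

/-- The Garside structure of `B₄` given by the positive braids and the half twist. -/
def artinStructure : GarsideStructure (BraidGroup 4) where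
  P := positive
  Δ := garsideElement
  Δ_mem := braid_mem _
  eq_one_of_mem_of_inv_mem a ha ha' := by
    have h₁ := exponentSum_nonneg ha
    have h₂ := exponentSum_nonneg ha'
    have h₃ := exponentSum_mul a a⁻¹
    have h₄ := exponentSum_braid []
    simp only [braid, List.map_nil, List.prod_nil, List.length_nil, Nat.cast_zero] at h₄
    rw [mul_inv_cancel, h₄] at h₃
    exact eq_one_of_exponentSum_eq_zero ha (by omega)
  exists_gcd := exists_gcd
  exists_lcm := exists_lcm
  closure_simples := by
    rw [eq_top_iff, ← PresentedGroup.closure_range_of, Subgroup.closure_le]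
    rintro _ ⟨i, rfl⟩
    change PresentedGroup.of i ∈ Subgroup.closure _
    refine Subgroup.subset_closure ⟨?_, ?_⟩
    · rw [PrefixLE, inv_one, one_mul]
      exact braidGen_mem i
    obtain ⟨X, hX⟩ := exists_garsideWord_equiv_cons i
    change (braidGen 4 i)⁻¹ * _ ∈ positive
    rw [garsideElement, hX.braid_eq, braid_cons, inv_mul_cancel_left]
    exact braid_mem X
  conj_mem_iff a := by
    have h : ∀ a ∈ positive, garsideElement⁻¹ * a * garsideElement ∈ positive := by
      intro a ha
      obtain ⟨X, rfl⟩ := mem_positive_iff.1 ha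
      rw [mul_assoc, braid_mul_garsideElement, inv_mul_cancel_left]
      exact braid_mem _
    refine ⟨fun ha => ?_, h a⟩
    -- conjugating twice is conjugation by the central element `Δ²`
    have h₁ := h _ ha
    have h₂ := (garsideElement_sq_comm a).eq
    rw [sq] at h₂
    have h₃ : garsideElement⁻¹ * (garsideElement⁻¹ * a * garsideElement) * garsideElement = a := by
      simp only [mul_assoc]
      rw [← h₂]
      group
    rwa [h₃] at h₁
  exists_norm_bound x _ _ := by
    have h : ∀ l : List (BraidGroup 4), (∀ a ∈ l, a ∈ positive ∧ a ≠ 1) →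
        (l.length : ℤ) ≤ exponentSum l.prod := by
      intro l
      induction l with
      | nil => simp [exponentSum]
      | cons a l ih =>
        intro hl
        have ha := hl a (by simp)
        have h₁ := exponentSum_nonneg ha.1
        have h₂ : exponentSum a ≠ 0 := fun h => ha.2 (eq_one_of_exponentSum_eq_zero ha.1 h)
        have h₃ := ih fun b hb => hl b (by simp [hb])
        rw [List.prod_cons, exponentSum_mul, List.length_cons]
        push_cast
        omega
    refine ⟨(exponentSum x).toNat, fun l hl hx => ?_⟩
    have := h l hl
    rw [hx] at this
    omega

theorem isArtinStructureB4_artinStructure : IsArtinStructureB4 artinStructure := by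
  refine ⟨rfl, ?_⟩
  simp [artinStructure, garsideElement, garsideWord, braid, mul_assoc]

theorem finiteType_artinStructure : artinStructure.FiniteType := by
  refine ((List.finite_length_le (Fin 3) 6).image braid).subset ?_
  rintro s ⟨h₁, h₂⟩
  rw [PrefixLE, inv_one, one_mul] at h₁
  obtain ⟨X, rfl⟩ := mem_positive_iff.1 h₁
  refine ⟨X, ?_, rfl⟩
  have h := exponentSum_le h₂
  change _ ≤ exponentSum (braid garsideWord) at h
  rw [exponentSum_braid, exponentSum_braid] at h
  exact_mod_cast h

end PositiveBraid

namespace GarsideStructure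

variable {G : Type*} [Group G] {S : GarsideStructure G}

/-! ### Cyclic sliding of simple elements -/

theorem inf_and_sup_of_mem_simples (hΔ : S.Δ ≠ 1) {s : G} (hs : s ∈ S.simples) (h₁ : s ≠ 1)
    (h₂ : s ≠ S.Δ) : S.inf s = 0 ∧ S.sup s = 1 := by
  have h : S.IsLeftNormalForm s 0 [s] := ⟨by simp, by simp [hs, h₁, h₂], by simp⟩
  constructor
  · refine _root_.eq_of_forall_le_iff fun n => ?_
    rw [← zpow_le_iff hΔ, h.zpow_le_iff hΔ]
  · refine eq_of_forall_ge_iff fun n => ?_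
    rw [← le_zpow_iff hΔ, h.le_zpow_iff hΔ]
    simp

theorem preferredPrefix_of_mem_simples (hΔ : S.Δ ≠ 1) {s : G} (hs : s ∈ S.simples) (h₁ : s ≠ 1)
    (h₂ : s ≠ S.Δ) : S.preferredPrefix s = S.gcd s (s⁻¹ * S.Δ) := by
  obtain ⟨hinf, hsup⟩ := inf_and_sup_of_mem_simples hΔ hs h₁ h₂
  rw [preferredPrefix_eq hΔ, hinf, hsup, neg_zero, zpow_zero, mul_one, zpow_one,
    gcd_eq_left hs.2]

end GarsideStructure

namespace PositiveBraid

open WordEquiv GarsideStructure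

/-! ### The braid `σ₁ σ₂ σ₃` is not in its set of sliding circuits -/

theorem artinStructure_Δ_ne_one : artinStructure.Δ ≠ 1 := by
  intro h
  have h₁ := exponentSum_braid garsideWord
  have h₂ := exponentSum_braid []
  rw [show braid garsideWord = 1 from h] at h₁
  rw [show braid [] = 1 from rfl, h₁] at h₂
  simp [garsideWord] at h₂

theorem braid_mem_simples {X Y : List (Fin 3)} (h : WordEquiv (X ++ Y) garsideWord) :
    braid X ∈ artinStructure.simples ∧ (braid X)⁻¹ * artinStructure.Δ = braid Y := by
  have h' : (braid X)⁻¹ * artinStructure.Δ = braid Y := by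
    change (braid X)⁻¹ * braid garsideWord = _
    rw [← h.braid_eq, braid_append, inv_mul_cancel_left]
  refine ⟨⟨?_, ?_⟩, h'⟩
  · change 1⁻¹ * braid X ∈ positive
    simpa using braid_mem X
  · rw [PrefixLE, h']
    exact braid_mem Y

theorem braid_ne_of_length_ne {X Y : List (Fin 3)} (h : X.length ≠ Y.length) :
    braid X ≠ braid Y :=
  fun he => h (wordEquiv_of_braid_eq he).length_eq

theorem preferredPrefix_braid {X Y : List (Fin 3)} (h : WordEquiv (X ++ Y) garsideWord)
    (hX : X.length = 3) :
    artinStructure.preferredPrefix (braid X) = artinStructure.gcd (braid X) (braid Y) := by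
  obtain ⟨hs, hY⟩ := braid_mem_simples h
  rw [preferredPrefix_of_mem_simples artinStructure_Δ_ne_one hs
    (braid_ne_of_length_ne (Y := []) (by simp [hX]))
    (braid_ne_of_length_ne (Y := garsideWord) (by simp [hX, garsideWord])), hY]

theorem garsideWord_equiv_coxeter : WordEquiv ([0, 1, 2] ++ [0, 1, 0]) garsideWord :=
  (step [0, 1] 0 2 [1, 0]).symm

theorem garsideWord_equiv_bipartite : WordEquiv ([0, 2, 1] ++ [0, 2, 1]) garsideWord :=
  (((step [0, 2, 1] 0 2 [1]).trans (step [0] 2 1 [0, 1])).trans (step [0, 1, 2] 1 0 [])).trans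
    (step [0, 1] 2 0 [1, 0])

theorem gcd_coxeter : artinStructure.gcd (braid [0, 1, 2]) (braid [0, 1, 0]) = braid [0, 1] := by
  have e : ∀ i : Fin 3, braid [0, 1, i] = braid [0, 1] * braid [i] := fun i =>
    braid_append [0, 1] [i]
  rw [e, e, ← mul_gcd]
  suffices h : artinStructure.gcd (braid [2]) (braid [0]) = 1 by rw [h, mul_one]
  -- the first letter of a common divisor of `σ₃` and `σ₁` would be equal to both
  set d := artinStructure.gcd (braid [2]) (braid [0]) with hd
  have hone : d ∈ positive := by
    have hpos : ∀ X, PrefixLE artinStructure.P 1 (braid X) := fun X =>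
      (artinStructure.one_le_iff _).2 (braid_mem X)
    exact (artinStructure.one_le_iff d).1 ((artinStructure.le_gcd_iff _ _ _).2 ⟨hpos _, hpos _⟩)
  have h₂ : d⁻¹ * braid [2] ∈ positive := artinStructure.gcd_le_left _ _
  have h₀ : d⁻¹ * braid [0] ∈ positive := artinStructure.gcd_le_right _ _
  obtain ⟨X, hX⟩ := mem_positive_iff.1 hone
  obtain ⟨Y, hY⟩ := mem_positive_iff.1 h₂
  obtain ⟨Z, hZ⟩ := mem_positive_iff.1 h₀
  rw [inv_mul_eq_iff_eq_mul, hX, ← braid_append, braid_eq_iff] at hY hZ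
  rcases X with _ | ⟨i, X⟩
  · rw [hX]; rfl
  · obtain ⟨V, hV, -⟩ := cons_inv hY
    obtain ⟨W, hW, -⟩ := cons_inv hZ
    have l₁ := hV.length_eq
    have l₂ := hW.length_eq
    simp only [List.length_append, List.length_nil] at l₁ l₂
    have hne : ∀ i : Fin 3, ¬ ((complement 2 i).length = 0 ∧ (complement 0 i).length = 0) := by
      decide
    exact absurd ⟨by omega, by omega⟩ (hne i)

theorem cyclicSliding_coxeter :
    artinStructure.cyclicSliding (braid [0, 1, 2]) = braid [0, 2, 1] := by
  rw [cyclicSliding, preferredPrefix_braid garsideWord_equiv_coxeter rfl, gcd_coxeter]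
  rw [mul_assoc, inv_mul_eq_iff_eq_mul, ← braid_append, ← braid_append, braid_eq_iff]
  exact append_left [0, 1] (rel 2 0 [1])

theorem cyclicSliding_bipartite :
    artinStructure.cyclicSliding (braid [0, 2, 1]) = braid [0, 2, 1] := by
  rw [cyclicSliding, preferredPrefix_braid garsideWord_equiv_bipartite rfl,
    gcd_eq_left (artinStructure.le_refl _), inv_mul_cancel, one_mul]

theorem braid_coxeter_ne_bipartite : braid [0, 1, 2] ≠ braid [0, 2, 1] := by
  intro h
  obtain ⟨Z, hZ, -⟩ := cons_inv (cancel_left (W := [0]) (wordEquiv_of_braid_eq h))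
  have := hZ.length_eq
  rw [show complement 1 2 = [2, 1] from rfl] at this
  simp at this

theorem coxeter_notMem_SC : braid [0, 1, 2] ∉ artinStructure.SC (braid [0, 1, 2]) := by
  rintro ⟨-, m, hm, h⟩
  obtain ⟨n, rfl⟩ : ∃ n, m = n + 1 := ⟨m - 1, by omega⟩
  rw [Function.iterate_succ_apply, cyclicSliding_coxeter,
    Function.iterate_fixed cyclicSliding_bipartite] at h
  exact braid_coxeter_ne_bipartite h.symm

theorem coxeter_mem_SSS : braid [0, 1, 2] ∈ artinStructure.SSS (braid [0, 1, 2]) ∧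
    artinStructure.len (braid [0, 1, 2]) = 1 := by
  have hs := inf_and_sup_of_mem_simples artinStructure_Δ_ne_one
    (braid_mem_simples garsideWord_equiv_coxeter).1 (braid_ne_of_length_ne (Y := []) (by simp))
    (braid_ne_of_length_ne (Y := garsideWord) (by simp [garsideWord]))
  have hlen : artinStructure.len (braid [0, 1, 2]) = 1 := by
    have := artinStructure.sup_sub_inf (braid [0, 1, 2])
    rw [hs.1, hs.2] at this
    omega
  exact ⟨mem_SSS_of_len_le_one artinStructure_Δ_ne_one finiteType_artinStructure
    mem_conjugatesOf_self hlen.le, hlen⟩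

end PositiveBraid

theorem mainTheorem3 :
    (∀ (G : Type*) [Group G] (S : GarsideStructure G), S.FiniteType → ∀ x : G,
      (S.SC x ⊆ S.RSSS x ∧ S.RSSS x ⊆ S.USS x ∧ S.USS x ⊆ S.SSS x ∧ S.SSS x ⊆ S.SS x) ∧
      (1 < S.summitLen x → S.SC x = S.RSSS x) ∧
      (S.summitLen x = 1 →
        S.SC x ⊆ S.RSSS x ∧ S.RSSS x = S.USS x ∧ S.USS x = S.SSS x)) ∧
    (∃ S : GarsideStructure (BraidGroup 4), IsArtinStructureB4 S ∧ S.FiniteType ∧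
      S.summitLen (braidGen 4 0 * braidGen 4 1 * braidGen 4 2) = 1 ∧
      S.SC (braidGen 4 0 * braidGen 4 1 * braidGen 4 2) ⊂
        S.RSSS (braidGen 4 0 * braidGen 4 1 * braidGen 4 2)) := by
  refine ⟨fun G _ S hS x => GarsideStructure.invariant_sets_of_finiteType hS x,
    PositiveBraid.artinStructure, PositiveBraid.isArtinStructureB4_artinStructure,
    PositiveBraid.finiteType_artinStructure, ?_⟩
  have hx : braidGen 4 0 * braidGen 4 1 * braidGen 4 2 = PositiveBraid.braid [0, 1, 2] := by
    simp [PositiveBraid.braid, mul_assoc]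
  obtain ⟨hmem, hlen⟩ := PositiveBraid.coxeter_mem_SSS
  have hsummit := (GarsideStructure.len_eq_summitLen hmem).symm.trans hlen
  obtain ⟨-, -, h⟩ := GarsideStructure.invariant_sets_of_finiteType
    PositiveBraid.finiteType_artinStructure (PositiveBraid.braid [0, 1, 2])
  obtain ⟨h₁, h₂, h₃⟩ := h hsummit
  rw [hx]
  refine ⟨hsummit, h₁, fun hsub => PositiveBraid.coxeter_notMem_SC (hsub ?_)⟩
  rw [h₂, h₃]
  exact hmem
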